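/- A term over the variables $x_1,\dots,x_n$ is a finite set of literals ($x_i$ or $\neg x_i$) in which different literals have different variables; a DNF over these variables is a finite set $D$ of terms, and it is a $k$-DNF if each of its terms has at most $k$ literals. A model of $D$ is an assignment $\{x_1,\dots,x_n\}\to\{0,1\}$ that satisfies all literals of some term of $D$. Consider random access machines (finite programs on registers $R_0,R_1,\dots$ holding natural numbers) with addition, subtraction, multiplication, copying, indirect addressing, jumps, reading of the next input letter, and an operation that outputs the concatenation of the contents of a block of consecutive registers in one unit of time; every operation takes one unit of time, except that the arithmetic ones take time linear in the binary length of their operands. The average delay of a halting run with at least one output is its total time (from the start, reading of the input included, until it halts) divided by the number of words output. **Theorem.** There is an algorithm that enumerates the models of a $k$-DNF with average delay $O(2^{3k/2})$. That is, there are a single random access machine program and a constant $C$ such that for all $k,n\ge 0$ and every $k$-DNF $D$ over $n$ variables, given in any encoding over a finite alphabet that consists of $n$ in binary followed by the terms of $D$, each listed once in any order as a repetition-free list, in any order, of its literals (a sign and the variable's index in binary), the program halts, having output each model of $D$ (as a word in $\{0,1\}^n$) exactly once and nothing else, and, if $D$ has at least one term, its average delay is at most $C\cdot 2^{3k/2}$.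 -/

import Mathlib

/-! ### Terms, DNF formulas and their models -/

namespace DNFEnum

/-- A literal over the variables `x_0, …, x_{n-1}`: the pair `(i, true)` is the variable `x_i` and
the pair `(i, false)` is its negation. -/
abbrev Literal (n : ℕ) := Fin n × Bool

/-- The value of a literal under an assignment. -/
def Literal.eval {n : ℕ} (α : Fin n → Bool) (l : Literal n) : Bool :=
  if l.2 then α l.1 else !(α l.1)

/-- A term is a finite set of literals in which two different literals have different variables. -/
def IsTerm {n : ℕ} (T : Finset (Literal n)) : Prop :=
  ∀ l ∈ T, ∀ l' ∈ T, l.1 = l'.1 → l = l'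

/-- A DNF formula over `n` variables: a finite set of terms. The formula may have no term, a term
may be empty, and a variable need not occur in the formula. -/
structure DNF (n : ℕ) where
  terms : Finset (Finset (Literal n))
  isTerm : ∀ T ∈ terms, IsTerm T

/-- A `k`-DNF is a DNF all of whose terms have at most `k` literals. -/
def DNF.IsKDNF {n : ℕ} (D : DNF n) (k : ℕ) : Prop :=
  ∀ T ∈ D.terms, T.card ≤ k

/-- `α` is a model of `D`: it satisfies all the literals of some term of `D`. -/
def DNF.IsModel {n : ℕ} (D : DNF n) (α : Fin n → Bool) : Prop :=
  ∃ T ∈ D.terms, ∀ l ∈ T, Literal.eval α l = true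

/-! ### Random access machines -/

namespace RAM

/-- The instructions of the machine. Every register `R i`, `i = 0, 1, 2, …`, holds a natural number
and the input is on a one-way read-only tape. -/
inductive Instr where
  /-- `R i := c` -/
  | const (i c : ℕ)
  /-- `R i := R j` -/
  | copy (i j : ℕ)
  /-- `R i := R (R j)` -/
  | load (i j : ℕ)
  /-- `R (R i) := R j` -/
  | store (i j : ℕ)
  /-- `R i := R j + R l` -/
  | add (i j l : ℕ)
  /-- `R i := R j - R l` (and `0` if `R j < R l`) -/
  | sub (i j l : ℕ)
  /-- `R i := R j * R l` -/
  | mul (i j l : ℕ)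
  /-- continue at position `t` of the program -/
  | jump (t : ℕ)
  /-- continue at position `t` of the program if `R i = 0` -/
  | jumpZero (i t : ℕ)
  /-- put the next input symbol into `R i` (`0` if the input is exhausted) -/
  | read (i : ℕ)
  /-- output the concatenation of the values of `R a, R (a + 1), …, R b`, where `a = R i` and
  `b = R j` (the empty word if `b < a`) -/
  | output (i j : ℕ)

/-- A program is a finite list of instructions. -/
abbrev Program := List Instr

/-- A configuration of the machine. -/
structure Config where
  /-- position of the next instruction -/
  pc : ℕ
  /-- contents of the registers -/
  reg : ℕ → ℕ
  /-- the part of the input that has not been read yet -/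
  inp : List ℕ
  /-- the words output so far, in chronological order -/
  out : List (List ℕ)
  /-- the time spent so far -/
  time : ℕ

/-- The time taken by one execution of an instruction: one unit, except for the arithmetic
instructions, which take time linear in the size (number of binary digits) of their operands. -/
def Instr.cost (R : ℕ → ℕ) : Instr → ℕ
  | .add _ j l => 1 + Nat.size (R j) + Nat.size (R l)
  | .sub _ j l => 1 + Nat.size (R j) + Nat.size (R l)
  | .mul _ j l => 1 + Nat.size (R j) + Nat.size (R l)
  | _ => 1

/-- The effect of an instruction on everything but the time. -/
def Instr.effect (c : Config) : Instr → Config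
  | .const i a => { c with pc := c.pc + 1, reg := Function.update c.reg i a }
  | .copy i j => { c with pc := c.pc + 1, reg := Function.update c.reg i (c.reg j) }
  | .load i j => { c with pc := c.pc + 1, reg := Function.update c.reg i (c.reg (c.reg j)) }
  | .store i j => { c with pc := c.pc + 1, reg := Function.update c.reg (c.reg i) (c.reg j) }
  | .add i j l => { c with pc := c.pc + 1, reg := Function.update c.reg i (c.reg j + c.reg l) }
  | .sub i j l => { c with pc := c.pc + 1, reg := Function.update c.reg i (c.reg j - c.reg l) }
  | .mul i j l => { c with pc := c.pc + 1, reg := Function.update c.reg i (c.reg j * c.reg l) }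
  | .jump t => { c with pc := t }
  | .jumpZero i t => { c with pc := if c.reg i = 0 then t else c.pc + 1 }
  | .read i =>
      { c with pc := c.pc + 1, reg := Function.update c.reg i (c.inp.headD 0), inp := c.inp.tail }
  | .output i j =>
      { c with
        pc := c.pc + 1
        out := c.out ++ [(List.range' (c.reg i) (c.reg j + 1 - c.reg i)).map c.reg] }

/-- One step of the machine; the machine halts (`none`) when it leaves its program. -/
def step (P : Program) (c : Config) : Option Config :=
  (P[c.pc]?).map fun ins => { ins.effect c with time := c.time + ins.cost c.reg }

/-- The initial configuration on input `w`: all the registers are zero. -/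
def init (w : List ℕ) : Config :=
  { pc := 0, reg := fun _ => 0, inp := w, out := [], time := 0 }

/-- Started on input `w`, the program `P` halts after total time `t`, having output the words `ys`
in this order. -/
def HaltsWith (P : Program) (w : List ℕ) (ys : List (List ℕ)) (t : ℕ) : Prop :=
  ∃ c : Config, Relation.ReflTransGen (fun c₁ c₂ => step P c₁ = some c₂) (init w) c ∧
    step P c = none ∧ c.out = ys ∧ c.time = t

end RAM

/-- The average delay of a run that takes total time `t` and outputs the words `ys` (at least one):
the total time divided by the number of output words. -/
noncomputable def averageDelay (t : ℕ) (ys : List (List ℕ)) : ℝ := (t : ℝ) / (ys.length : ℝ)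

/-! ### Encoding of formulas and models -/

/-- The input alphabet: two binary digits, two marks that start a negative or a positive literal,
and a mark that starts a term. -/
inductive Letter where
  | zero | one | neg | pos | term

/-- The number by which a letter is presented to the machine (`0` marks the end of the input). -/
def Letter.code : Letter → ℕ
  | .zero => 1
  | .one => 2
  | .neg => 3
  | .pos => 4
  | .term => 5

/-- Binary notation, most significant digit first. -/
def encodeNat (m : ℕ) : List Letter :=
  (Nat.bits m).reverse.map fun b => if b then Letter.one else Letter.zero

def encodeLiteral {n : ℕ} (l : Literal n) : List Letter :=
  (if l.2 then Letter.pos else Letter.neg) :: encodeNat l.1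

def encodeTerm {n : ℕ} (t : List (Literal n)) : List Letter :=
  Letter.term :: t.flatMap encodeLiteral

/-- The number of variables followed by the terms. -/
def encodeTerms {n : ℕ} (L : List (List (Literal n))) : List Letter :=
  encodeNat n ++ L.flatMap encodeTerm

/-- `L` lists every term of `D` exactly once, in some order, and each term is given by the list of
its literals without repetition, in some order. -/
def IsListing {n : ℕ} (L : List (List (Literal n))) (D : DNF n) : Prop :=
  (∀ t ∈ L, t.Nodup) ∧ (L.map List.toFinset).Nodup ∧ ∀ T, T ∈ L.map List.toFinset ↔ T ∈ D.terms

/-- The word `x` is an encoding of the formula `D`. -/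
def Encodes {n : ℕ} (x : List Letter) (D : DNF n) : Prop :=
  ∃ L : List (List (Literal n)), IsListing L D ∧ x = encodeTerms L

/-- The word over `{0, 1}` that lists the values of an assignment. -/
def modelWord {n : ℕ} (α : Fin n → Bool) : List ℕ :=
  List.ofFn fun i => if α i then 1 else 0

/-- `ys` lists the models of `D`, each of them exactly once. -/
def EnumeratesModels {n : ℕ} (ys : List (List ℕ)) (D : DNF n) : Prop :=
  ys.Nodup ∧ ∀ y, y ∈ ys ↔ ∃ α : Fin n → Bool, D.IsModel α ∧ y = modelWord α

end DNFEnum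

/-! The algorithm is a depth-first search that fixes the variables from the last to the first. A
node of level `r` holds a set `S` of terms over `r` variables. Its child for the bit `b` holds the
terms compatible with `b`, with the literal on the top variable removed and duplicates merged
(`restr`). Only children with a nonempty set are entered. Since a nonempty set of terms has a model,
every visited node has a model below it, and every leaf gives one output. Correctness is
`mem_models` and `nodup_models`.

The delay bound rests on a lower bound for the number `M` of models of `m` distinct terms of width
at most `k` over `r` variables. Take `0 ≤ x ≤ 1` and count the pairs of a model and a term that it
satisfies, giving a term `T` the factor `x ^ |T|`. Summing over terms first gives `∑ 2 ^ r * (x / 2)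
^ |T|`, which is at least `m * 2 ^ r * (x / 2) ^ k`. Summing over models first gives at most `(1 +
x) ^ r * M`, because a term satisfied by a given model is determined by its set of variables. With
`ρ = (1 + x) / 2` this reads `m ≤ ρ ^ r * (2 / x) ^ k * M` when `x > 0` (`card_le_numModels`, proved
via `weight_le` by induction along the search tree).

A node of level `r` with `m` terms costs `O((r + 2) ^ 2 * (m + 1))`. The model counts of the nodes
of one level add up to `M`, so level `r` costs `O((r + 2) ^ 2 * ρ ^ r * (2 / x) ^ k * M)` in all. If
`x < 1`, then `ρ < 1` and the sum over the levels converges (`searchCost_le`). Reading the input, of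
cost `O((n + 2) ^ 3 * (m + 1))`, is absorbed in the same way. The choice `x = 1 / √2` makes `(2 / x)
^ k` equal to `2 ^ (3 * k / 2)` (`exists_time_bound`).

On the machine, the cost of a node must depend on its own level `r` and not on `n`. Terms are coded
by ternary numbers below `3 ^ r`, so the operands have `O(r)` binary digits. The addresses of the
output cells are tabulated in advance and never enter into arithmetic. Duplicates are detected in
constantly many steps by a list with a table of positions that need not be initialised. The program
is written in a small structured language. `Exec.reaches` proves its compilation correct, and
`Exec.real` turns step counts into machine time. `search_spec` bounds the time of the search by
`searchCost`, and `prepare_spec` treats the reading of the input. -/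

namespace DNFEnum
open RAM

/-! ### Structured programs -/

/-- The data of a configuration: everything but the position in the program. -/
structure St where
  reg : ℕ → ℕ
  inp : List ℕ
  out : List (List ℕ)
  time : ℕ

namespace St

/-- The configuration with data `s` at position `p`. -/
def config (s : St) (p : ℕ) : Config := ⟨p, s.reg, s.inp, s.out, s.time⟩

/-- Let `d` units of time pass. -/
def tick (s : St) (d : ℕ) : St := { s with time := s.time + d }

/-- Reset the clock. -/
def withTime (s : St) (t : ℕ) : St := { s with time := t }

/-- Execute an instruction, at the price of `d` units of time. -/
def exec (s : St) (i : Instr) (d : ℕ) : St :=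
  ⟨(i.effect (s.config 0)).reg, (i.effect (s.config 0)).inp, (i.effect (s.config 0)).out,
    s.time + d⟩

end St

/-- The instructions that are not jumps. -/
def IsStraight : Instr → Prop
  | .jump _ => False
  | .jumpZero _ _ => False
  | _ => True

/-- Structured programs. -/
inductive Cmd where
  | skip
  | prim (i : Instr)
  | seq (a b : Cmd)
  /-- if `R x ≠ 0` then `a` else `b` -/
  | ite (x : ℕ) (a b : Cmd)
  /-- while `R x ≠ 0` do `a` -/
  | loop (x : ℕ) (a : Cmd)

infixr:60 " ;; " => Cmd.seq

/-- A cost model: which instructions may be executed, and at which price. -/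
structure CostModel where
  ok : Instr → (ℕ → ℕ) → Prop
  cost : Instr → (ℕ → ℕ) → ℕ

/-- The cost model of the machine. -/
def realCost : CostModel := ⟨fun i _ => IsStraight i, fun i R => i.cost R⟩

/-- The operands of an arithmetic instruction have less than `l` binary digits. -/
def OperandsLt (l : ℕ) (R : ℕ → ℕ) : Instr → Prop
  | .add _ i j => R i < 2 ^ l ∧ R j < 2 ^ l
  | .sub _ i j => R i < 2 ^ l ∧ R j < 2 ^ l
  | .mul _ i j => R i < 2 ^ l ∧ R j < 2 ^ l
  | _ => True

/-- Unit cost, with operands of at most `l` binary digits. -/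
def cappedCost (l : ℕ) : CostModel := ⟨fun i R => IsStraight i ∧ OperandsLt l R i, fun _ _ => 1⟩

/-- Big-step semantics of structured programs. -/
inductive Exec (μ : CostModel) : Cmd → St → St → Prop
  | skip (s) : Exec μ .skip s s
  | prim (i s) : μ.ok i s.reg → Exec μ (.prim i) s (s.exec i (μ.cost i s.reg))
  | seq {a b s₁ s₂ s₃} : Exec μ a s₁ s₂ → Exec μ b s₂ s₃ → Exec μ (.seq a b) s₁ s₃
  | iteTrue {x a b s s'} : s.reg x ≠ 0 → Exec μ a (s.tick 1) s' →
      Exec μ (.ite x a b) s (s'.tick 1)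
  | iteFalse {x a b s s'} : s.reg x = 0 → Exec μ b (s.tick 1) s' → Exec μ (.ite x a b) s s'
  | loopDone {x a s} : s.reg x = 0 → Exec μ (.loop x a) s (s.tick 1)
  | loopStep {x a s s₁ s₂} : s.reg x ≠ 0 → Exec μ a (s.tick 1) s₁ →
      Exec μ (.loop x a) (s₁.tick 1) s₂ → Exec μ (.loop x a) s s₂

/-- Compilation of a structured program that is placed at position `o`. -/
def Cmd.compile : ℕ → Cmd → List Instr
  | _, .skip => []
  | _, .prim i => [i]
  | o, .seq a b => a.compile o ++ b.compile (o + (a.compile o).length)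
  | o, .ite x a b =>
      .jumpZero x (o + (a.compile (o + 1)).length + 2) :: (a.compile (o + 1) ++
        .jump (o + (a.compile (o + 1)).length + 2 +
          (b.compile (o + (a.compile (o + 1)).length + 2)).length) ::
        b.compile (o + (a.compile (o + 1)).length + 2))
  | o, .loop x a =>
      .jumpZero x (o + (a.compile (o + 1)).length + 2) :: (a.compile (o + 1) ++ [.jump o])

/-- The machine gets from one configuration to another. -/
abbrev Reaches (P : Program) : Config → Config → Prop :=
  Relation.ReflTransGen (fun c₁ c₂ => step P c₁ = some c₂)

/-! ### Correctness of compilation -/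

theorem effect_straight {i : Instr} (hi : IsStraight i) (s : St) (p : ℕ) :
    i.effect (s.config p) =
      ⟨p + 1, (i.effect (s.config 0)).reg, (i.effect (s.config 0)).inp,
        (i.effect (s.config 0)).out, s.time⟩ := by
  cases i <;> simp_all [IsStraight, Instr.effect, St.config]

theorem getElem?_append_cons {A : List Instr} {i : Instr} {B : List Instr} {o : ℕ}
    (h : A.length = o) : (A ++ i :: B)[o]? = some i := by
  subst h; simp

/-- Compiled programs do what their source does. -/
theorem Exec.reaches {c : Cmd} {s s' : St} (h : Exec realCost c s s') :
    ∀ (P A B : Program) (o : ℕ), A.length = o → P = A ++ (c.compile o ++ B) →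
      Reaches P (s.config o) (s'.config (o + (c.compile o).length)) := by
  induction h with
  | skip s => intro P A B o hA hP; exact .refl
  | prim i s hi =>
    intro P A B o hA hP
    refine .single ?_
    have hi' : IsStraight i := hi
    have hg : P[(s.config o).pc]? = some i := by
      rw [hP]; exact getElem?_append_cons hA
    rw [step, hg, Option.map_some, effect_straight hi']
    rfl
  | @seq a b s₁ s₂ s₃ _ _ iha ihb =>
    intro P A B o hA hP
    have h1 := iha P A (b.compile (o + (a.compile o).length) ++ B) o hA
      (by rw [hP]; simp [Cmd.compile])
    have h2 := ihb P (A ++ a.compile o) B (o + (a.compile o).length) (by simp [hA])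
      (by rw [hP]; simp [Cmd.compile])
    refine h1.trans ?_
    simpa [Cmd.compile, Nat.add_assoc] using h2
  | @iteTrue x a b s s' hx _ iha =>
    intro P A B o hA hP
    simp only [Cmd.compile] at hP
    set a' := a.compile (o + 1) with ha'
    set b' := b.compile (o + a'.length + 2) with hb'
    have h1 : Reaches P (s.config o) ((s.tick 1).config (o + 1)) := by
      refine .single ?_
      have hg : P[(s.config o).pc]? = some (.jumpZero x (o + a'.length + 2)) := by
        rw [hP]; exact getElem?_append_cons hA
      have hx' : (s.config o).reg x ≠ 0 := hx
      simp only [step, hg, Option.map_some, Instr.effect, if_neg hx']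
      rfl
    have h2 := iha P (A ++ [.jumpZero x (o + a'.length + 2)])
      (.jump (o + a'.length + 2 + b'.length) :: b' ++ B) (o + 1) (by simp [hA])
      (by rw [hP]; simp [a'])
    -- The jump over the else-branch accounts for the second tick in `Exec.iteTrue`; the else-branch
    -- falls through and has none.
    have h3 : Reaches P (s'.config (o + 1 + a'.length))
        ((s'.tick 1).config (o + a'.length + 2 + b'.length)) := by
      refine .single ?_
      have hg : P[(s'.config (o + 1 + a'.length)).pc]? =
          some (.jump (o + a'.length + 2 + b'.length)) := by
        have : P = (A ++ .jumpZero x (o + a'.length + 2) :: a') ++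
            .jump (o + a'.length + 2 + b'.length) :: (b' ++ B) := by rw [hP]; simp
        rw [this]
        exact getElem?_append_cons (by simp [hA, St.config]; omega)
      simp only [step, hg, Option.map_some, Instr.effect]
      rfl
    have h4 := (h1.trans h2).trans h3
    convert h4 using 2
    simp only [Cmd.compile, List.length_cons, List.length_append, ← ha', ← hb']
    omega
  | @iteFalse x a b s s' hx _ ihb =>
    intro P A B o hA hP
    simp only [Cmd.compile] at hP
    set a' := a.compile (o + 1) with ha'
    set b' := b.compile (o + a'.length + 2) with hb'
    have h1 : Reaches P (s.config o) ((s.tick 1).config (o + a'.length + 2)) := by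
      refine .single ?_
      have hg : P[(s.config o).pc]? = some (.jumpZero x (o + a'.length + 2)) := by
        rw [hP]; exact getElem?_append_cons hA
      have hx' : (s.config o).reg x = 0 := hx
      simp only [step, hg, Option.map_some, Instr.effect, if_pos hx']
      rfl
    have h2 := ihb P (A ++ .jumpZero x (o + a'.length + 2) :: a' ++
      [.jump (o + a'.length + 2 + b'.length)]) B (o + a'.length + 2)
      (by simp [hA]; omega) (by rw [hP]; simp [hb'])
    have h4 := h1.trans h2
    convert h4 using 2
    simp only [Cmd.compile, List.length_cons, List.length_append, ← ha', ← hb']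
    omega
  | @loopDone x a s hx =>
    intro P A B o hA hP
    simp only [Cmd.compile] at hP
    set a' := a.compile (o + 1) with ha'
    have h1 : Reaches P (s.config o) ((s.tick 1).config (o + a'.length + 2)) := by
      refine .single ?_
      have hg : P[(s.config o).pc]? = some (.jumpZero x (o + a'.length + 2)) := by
        rw [hP]; exact getElem?_append_cons hA
      have hx' : (s.config o).reg x = 0 := hx
      simp only [step, hg, Option.map_some, Instr.effect, if_pos hx']
      rfl
    convert h1 using 2
    simp only [Cmd.compile, List.length_cons, List.length_append, ← ha', List.length_nil]
    omega
  | @loopStep x a s s₁ s₂ hx _ _ iha ihl =>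
    intro P A B o hA hP
    have hP' := hP
    simp only [Cmd.compile] at hP
    set a' := a.compile (o + 1) with ha'
    have h1 : Reaches P (s.config o) ((s.tick 1).config (o + 1)) := by
      refine .single ?_
      have hg : P[(s.config o).pc]? = some (.jumpZero x (o + a'.length + 2)) := by
        rw [hP]; exact getElem?_append_cons hA
      have hx' : (s.config o).reg x ≠ 0 := hx
      simp only [step, hg, Option.map_some, Instr.effect, if_neg hx']
      rfl
    have h2 := iha P (A ++ [.jumpZero x (o + a'.length + 2)])
      (.jump o :: B) (o + 1) (by simp [hA]) (by rw [hP]; simp [a'])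
    have h3 : Reaches P (s₁.config (o + 1 + a'.length)) ((s₁.tick 1).config o) := by
      refine .single ?_
      have hg : P[(s₁.config (o + 1 + a'.length)).pc]? = some (.jump o) := by
        have : P = (A ++ .jumpZero x (o + a'.length + 2) :: a') ++ .jump o :: B := by
          rw [hP]; simp
        rw [this]
        exact getElem?_append_cons (by simp [hA, St.config]; omega)
      simp only [step, hg, Option.map_some, Instr.effect]
      rfl
    exact ((h1.trans h2).trans h3).trans (ihl P A B o hA hP')

theorem Exec.haltsWith {c : Cmd} {w : List ℕ} {s' : St}
    (h : Exec realCost c ⟨fun _ => 0, w, [], 0⟩ s') :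
    HaltsWith (c.compile 0) w s'.out s'.time := by
  refine ⟨s'.config (0 + (c.compile 0).length),
    h.reaches (c.compile 0) [] [] 0 rfl (by simp), ?_, rfl, rfl⟩
  simp [step, St.config]

/-! ### From step counts to machine time -/

theorem IsStraight.cost_le {l : ℕ} {R : ℕ → ℕ} {i : Instr} (h : OperandsLt l R i) :
    i.cost R ≤ 2 * l + 1 := by
  cases i <;> simp only [Instr.cost, OperandsLt] at * <;>
    first
      | omega
      | (have h1 := Nat.size_le.2 h.1
         have h2 := Nat.size_le.2 h.2
         omega)

/-- From capped unit cost to the cost of the machine. -/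
theorem Exec.real {l : ℕ} {c : Cmd} {s s' : St} (h : Exec (cappedCost l) c s s') :
    s.time ≤ s'.time ∧ ∀ t, ∃ t', t' + (2 * l + 1) * s.time ≤ t + (2 * l + 1) * s'.time ∧
      Exec realCost c (s.withTime t) (s'.withTime t') := by
  induction h with
  | skip s => exact ⟨le_rfl, fun t => ⟨t, le_rfl, .skip _⟩⟩
  | prim i s hi =>
    refine ⟨by simp [St.exec, cappedCost], fun t => ⟨t + i.cost s.reg, ?_, ?_⟩⟩
    · have := IsStraight.cost_le hi.2
      simp only [St.exec, cappedCost]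
      nlinarith
    · have h : (s.exec i ((cappedCost l).cost i s.reg)).withTime (t + i.cost s.reg) =
          (s.withTime t).exec i (realCost.cost i (s.withTime t).reg) := by
        cases i <;> rfl
      rw [h]
      exact Exec.prim (μ := realCost) i (s.withTime t) hi.1
  | seq _ _ iha ihb =>
    refine ⟨iha.1.trans ihb.1, fun t => ?_⟩
    obtain ⟨t₁, h1, e1⟩ := iha.2 t
    obtain ⟨t₂, h2, e2⟩ := ihb.2 t₁
    exact ⟨t₂, by omega, .seq e1 e2⟩
  | @iteTrue x a b s s' hx _ iha =>
    refine ⟨by have := iha.1; simp only [St.tick] at *; omega, fun t => ?_⟩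
    obtain ⟨t₁, h1, e1⟩ := iha.2 (t + 1)
    refine ⟨t₁ + 1, ?_, Exec.iteTrue (s' := s'.withTime t₁) hx e1⟩
    simp only [St.tick] at *
    nlinarith
  | @iteFalse x a b s s' hx _ iha =>
    refine ⟨by have := iha.1; simp only [St.tick] at *; omega, fun t => ?_⟩
    obtain ⟨t₁, h1, e1⟩ := iha.2 (t + 1)
    refine ⟨t₁, ?_, Exec.iteFalse hx e1⟩
    simp only [St.tick] at *
    nlinarith
  | @loopDone x a s hx =>
    refine ⟨by simp [St.tick], fun t => ⟨t + 1, ?_, Exec.loopDone (s := s.withTime t) hx⟩⟩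
    simp only [St.tick] at *
    nlinarith
  | @loopStep x a s s₁ s₂ hx _ _ iha ihl =>
    refine ⟨by have := iha.1; have := ihl.1; simp only [St.tick] at *; omega, fun t => ?_⟩
    obtain ⟨t₁, h1, e1⟩ := iha.2 (t + 1)
    obtain ⟨t₂, h2, e2⟩ := ihl.2 (t₁ + 1)
    refine ⟨t₂, ?_, Exec.loopStep (s := s.withTime t) (s₁ := s₁.withTime t₁) hx e1 e2⟩
    simp only [St.tick] at *
    nlinarith

/-! ### Weakest preconditions under capped unit cost -/

/-- The program `c`, started in `s`, halts in a state that satisfies `Q`, with all operands below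
`2 ^ l`; the clock counts steps. -/
def wp (l : ℕ) (c : Cmd) (Q : St → Prop) (s : St) : Prop :=
  ∃ s', Exec (cappedCost l) c s s' ∧ Q s'

section wp

variable {l : ℕ} {Q Q' : St → Prop} {s : St}

theorem wp_mono {c : Cmd} (h : wp l c Q s) (hQ : ∀ s', Q s' → Q' s') : wp l c Q' s :=
  let ⟨s', h1, h2⟩ := h; ⟨s', h1, hQ s' h2⟩

theorem wp_skip : wp l .skip Q s ↔ Q s :=
  ⟨fun ⟨_, h, hQ⟩ => by cases h; exact hQ, fun h => ⟨s, .skip s, h⟩⟩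

theorem wp_seq {a b : Cmd} : wp l (a ;; b) Q s ↔ wp l a (wp l b Q) s :=
  ⟨fun ⟨s', h, hQ⟩ => by cases h with | seq h1 h2 => exact ⟨_, h1, _, h2, hQ⟩,
    fun ⟨_, h1, s', h2, hQ⟩ => ⟨s', .seq h1 h2, hQ⟩⟩

theorem wp_ite {x : ℕ} {a b : Cmd} : wp l (.ite x a b) Q s ↔
    (s.reg x ≠ 0 → wp l a (fun s' => Q (s'.tick 1)) (s.tick 1)) ∧
      (s.reg x = 0 → wp l b Q (s.tick 1)) := by
  constructor
  · rintro ⟨s', h, hQ⟩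
    cases h with
    | iteTrue hx h => exact ⟨fun _ => ⟨_, h, hQ⟩, fun h0 => absurd h0 hx⟩
    | iteFalse hx h => exact ⟨fun h0 => absurd hx h0, fun _ => ⟨_, h, hQ⟩⟩
  · rintro ⟨h1, h2⟩
    by_cases hx : s.reg x = 0
    · obtain ⟨s', h, hQ⟩ := h2 hx; exact ⟨s', .iteFalse hx h, hQ⟩
    · obtain ⟨s', h, hQ⟩ := h1 hx; exact ⟨_, .iteTrue hx h, hQ⟩

/-- There is no invariant rule for loops. Each loop is unrolled with `wp_loop_step` in an induction
on the data still to be processed and closed with this lemma. -/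
theorem wp_loop_done {x : ℕ} {a : Cmd} (hx : s.reg x = 0) (hQ : Q (s.tick 1)) :
    wp l (.loop x a) Q s := ⟨_, .loopDone hx, hQ⟩

theorem wp_loop_step {x : ℕ} {a : Cmd} (hx : s.reg x ≠ 0)
    (h : wp l a (fun s' => wp l (.loop x a) Q (s'.tick 1)) (s.tick 1)) :
    wp l (.loop x a) Q s :=
  let ⟨_, h1, s', h2, hQ⟩ := h; ⟨s', .loopStep hx h1 h2, hQ⟩

theorem wp_prim {i : Instr} : wp l (.prim i) Q s ↔
    (IsStraight i ∧ OperandsLt l s.reg i) ∧ Q (s.exec i 1) :=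
  ⟨fun ⟨_, h, hQ⟩ => by cases h with | prim _ _ hi => exact ⟨hi, hQ⟩,
    fun h => ⟨_, .prim (μ := cappedCost l) i s h.1, h.2⟩⟩

variable {i j k : ℕ}

theorem wp_const : wp l (.prim (.const i k)) Q s ↔
    Q ⟨Function.update s.reg i k, s.inp, s.out, s.time + 1⟩ := by
  simp [wp_prim, IsStraight, OperandsLt, St.exec, Instr.effect, St.config]

theorem wp_copy : wp l (.prim (.copy i j)) Q s ↔
    Q ⟨Function.update s.reg i (s.reg j), s.inp, s.out, s.time + 1⟩ := by
  simp [wp_prim, IsStraight, OperandsLt, St.exec, Instr.effect, St.config]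

theorem wp_load : wp l (.prim (.load i j)) Q s ↔
    Q ⟨Function.update s.reg i (s.reg (s.reg j)), s.inp, s.out, s.time + 1⟩ := by
  simp [wp_prim, IsStraight, OperandsLt, St.exec, Instr.effect, St.config]

theorem wp_store : wp l (.prim (.store i j)) Q s ↔
    Q ⟨Function.update s.reg (s.reg i) (s.reg j), s.inp, s.out, s.time + 1⟩ := by
  simp [wp_prim, IsStraight, OperandsLt, St.exec, Instr.effect, St.config]

theorem wp_add : wp l (.prim (.add i j k)) Q s ↔ (s.reg j < 2 ^ l ∧ s.reg k < 2 ^ l) ∧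
    Q ⟨Function.update s.reg i (s.reg j + s.reg k), s.inp, s.out, s.time + 1⟩ := by
  simp [wp_prim, IsStraight, OperandsLt, St.exec, Instr.effect, St.config]

theorem wp_sub : wp l (.prim (.sub i j k)) Q s ↔ (s.reg j < 2 ^ l ∧ s.reg k < 2 ^ l) ∧
    Q ⟨Function.update s.reg i (s.reg j - s.reg k), s.inp, s.out, s.time + 1⟩ := by
  simp [wp_prim, IsStraight, OperandsLt, St.exec, Instr.effect, St.config]

theorem wp_mul : wp l (.prim (.mul i j k)) Q s ↔ (s.reg j < 2 ^ l ∧ s.reg k < 2 ^ l) ∧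
    Q ⟨Function.update s.reg i (s.reg j * s.reg k), s.inp, s.out, s.time + 1⟩ := by
  simp [wp_prim, IsStraight, OperandsLt, St.exec, Instr.effect, St.config]

theorem wp_read : wp l (.prim (.read i)) Q s ↔
    Q ⟨Function.update s.reg i (s.inp.headD 0), s.inp.tail, s.out, s.time + 1⟩ := by
  simp [wp_prim, IsStraight, OperandsLt, St.exec, Instr.effect, St.config]

theorem wp_output : wp l (.prim (.output i j)) Q s ↔
    Q ⟨s.reg, s.inp, s.out ++ [(List.range' (s.reg i) (s.reg j + 1 - s.reg i)).map s.reg],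
      s.time + 1⟩ := by
  simp [wp_prim, IsStraight, OperandsLt, St.exec, Instr.effect, St.config]

end wp

/-! ### Arrays -/

/-- The register that holds entry `i` of array `j`; there are eight arrays, and the registers
below `64` do not belong to any of them. -/
def addr (j i : ℕ) : ℕ := 64 + 8 * i + j

theorem addr_inj {j j' i i' : ℕ} (hj : j < 8) (hj' : j' < 8) :
    addr j i = addr j' i' ↔ j = j' ∧ i = i' := by unfold addr; omega

theorem addr_eq_small {j i x : ℕ} (hx : x < 64) : addr j i = x ↔ False := by
  simp only [addr, iff_false]; omega

theorem small_eq_addr {j i x : ℕ} (hx : x < 64) : x = addr j i ↔ False := by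
  simp only [addr, iff_false]; omega

/-- `R x := A_j[R y]` -/
def aload (x j y : ℕ) : Cmd :=
  .prim (.const 0 8) ;; .prim (.mul 0 0 y) ;; .prim (.const 1 (64 + j)) ;; .prim (.add 0 0 1) ;;
    .prim (.load x 0)

/-- `A_j[R y] := R x` -/
def astore (j y x : ℕ) : Cmd :=
  .prim (.const 0 8) ;; .prim (.mul 0 0 y) ;; .prim (.const 1 (64 + j)) ;; .prim (.add 0 0 1) ;;
    .prim (.store 0 x)

section

variable {l : ℕ} {Q : St → Prop} {s : St} {x j y : ℕ}

/-- Registers 0 and 1 are scratch space for the address. Register 0 is overwritten before `R y` is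
read, whence `y ≠ 0`. -/
theorem wp_aload (hy : y ≠ 0) : wp l (aload x j y) Q s ↔
    ((8 < 2 ^ l ∧ s.reg y < 2 ^ l) ∧ (8 * s.reg y < 2 ^ l ∧ 64 + j < 2 ^ l)) ∧
    Q ⟨Function.update (Function.update (Function.update s.reg 0 (addr j (s.reg y))) 1 (64 + j))
      x (s.reg (addr j (s.reg y))), s.inp, s.out, s.time + 5⟩ := by
  have h : 8 * s.reg y + (64 + j) = addr j (s.reg y) := by unfold addr; ring
  have h0 : addr j (s.reg y) ≠ 0 := by unfold addr; omega
  have h1 : addr j (s.reg y) ≠ 1 := by unfold addr; omega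
  simp only [aload, wp_seq, wp_const, wp_mul, wp_add, wp_load, Function.update_self, ne_eq, hy,
    not_false_eq_true, Function.update_of_ne, h, h0, h1, zero_ne_one,
    Function.update_idem, and_assoc, Nat.add_assoc, Nat.reduceAdd]
  rw [Function.update_comm (a := 1) (b := 0) (by decide), Function.update_idem]

theorem wp_astore (hy : y ≠ 0) (hx : x ≠ 0) (hx' : x ≠ 1) :
    wp l (astore j y x) Q s ↔
    ((8 < 2 ^ l ∧ s.reg y < 2 ^ l) ∧ (8 * s.reg y < 2 ^ l ∧ 64 + j < 2 ^ l)) ∧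
    Q ⟨Function.update (Function.update (Function.update s.reg 0 (addr j (s.reg y))) 1 (64 + j))
      (addr j (s.reg y)) (s.reg x), s.inp, s.out, s.time + 5⟩ := by
  have h : 8 * s.reg y + (64 + j) = addr j (s.reg y) := by unfold addr; ring
  have h0 : addr j (s.reg y) ≠ 0 := by unfold addr; omega
  have h1 : addr j (s.reg y) ≠ 1 := by unfold addr; omega
  simp only [astore, wp_seq, wp_const, wp_mul, wp_add, wp_store, Function.update_self, ne_eq, hy,
    not_false_eq_true, Function.update_of_ne, h, hx, hx', zero_ne_one,
    Function.update_idem, and_assoc, Nat.add_assoc, Nat.reduceAdd]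
  rw [Function.update_comm (a := 1) (b := 0) (by decide), Function.update_idem]

end

end DNFEnum
namespace DNFEnum
open Finset

/-! ### Sets of terms as sets of ternary codes -/

/-- Number of nonzero ternary digits of `c` among the `r` lowest ones. -/
def width : ℕ → ℕ → ℕ
  | 0, _ => 0
  | r + 1, c => (if c / 3 ^ r = 0 then 0 else 1) + width r (c % 3 ^ r)

/-- A term with top digit `d` is compatible with the bit `b` for the top variable. -/
def Compat (b d : ℕ) : Prop := d = 0 ∨ d = b + 1

instance (b d : ℕ) : Decidable (Compat b d) := inferInstanceAs (Decidable (_ ∨ _))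

/-- The terms over `r` variables that remain of `S` when the top variable is set to `b`. -/
def restr (r b : ℕ) (S : Finset ℕ) : Finset ℕ :=
  (S.filter fun c => Compat b (c / 3 ^ r)).image (· % 3 ^ r)

/-- The models of a set of terms over `r` variables, in the order in which they are found, each
followed by `w`. -/
def models : ℕ → Finset ℕ → List ℕ → List (List ℕ)
  | 0, _, w => [w]
  | r + 1, S, w =>
    (if (restr r 0 S).Nonempty then models r (restr r 0 S) (0 :: w) else []) ++
      (if (restr r 1 S).Nonempty then models r (restr r 1 S) (1 :: w) else [])

/-- The number of models. -/
def numModels : ℕ → Finset ℕ → ℕ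
  | 0, _ => 1
  | r + 1, S =>
    (if (restr r 0 S).Nonempty then numModels r (restr r 0 S) else 0) +
      (if (restr r 1 S).Nonempty then numModels r (restr r 1 S) else 0)

theorem length_models (r : ℕ) (S : Finset ℕ) (w : List ℕ) :
    (models r S w).length = numModels r S := by
  induction r generalizing S w with
  | zero => rfl
  | succ r ih =>
    simp only [models, numModels, List.length_append]
    split_ifs <;> simp [ih]

/-- The word `w` satisfies the term with code `c`. -/
def Sat : ℕ → ℕ → List ℕ → Prop
  | 0, _, _ => True
  | r + 1, c, w => Compat (w.getD r 0) (c / 3 ^ r) ∧ Sat r (c % 3 ^ r) w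

theorem sat_congr {r c : ℕ} {w w' : List ℕ} (h : ∀ i < r, w.getD i 0 = w'.getD i 0) :
    Sat r c w ↔ Sat r c w' := by
  induction r generalizing c with
  | zero => rfl
  | succ r ih =>
    rw [Sat, Sat, h r (by omega), ih fun i hi => h i (by omega)]

theorem mem_restr {r b c : ℕ} {S : Finset ℕ} :
    c ∈ restr r b S ↔ ∃ d ∈ S, Compat b (d / 3 ^ r) ∧ d % 3 ^ r = c := by
  simp [restr, and_assoc]

/-- A word `v ++ [b]` satisfies a term iff `b` is compatible with its top digit and `v` satisfies
the rest, so a branch with an empty set of terms has no model to lose. Nonemptiness of `S` matters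
at level 0, where `models` lists a word whatever `S` is. -/
theorem mem_models {r : ℕ} {S : Finset ℕ} (hS : S.Nonempty) {w y : List ℕ} :
    y ∈ models r S w ↔ ∃ v : List ℕ, v.length = r ∧ (∀ b ∈ v, b ≤ 1) ∧ y = v ++ w ∧
      ∃ c ∈ S, Sat r c v := by
  induction r generalizing S w with
  | zero =>
    obtain ⟨c, hc⟩ := hS
    simp only [models, List.mem_singleton, Sat]
    constructor
    · rintro rfl; exact ⟨[], rfl, by simp, rfl, c, hc, trivial⟩
    · rintro ⟨v, hv, -, rfl, -⟩
      rw [List.length_eq_zero_iff.1 hv, List.nil_append]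
  | succ r ih =>
    have key : ∀ b ≤ 1, y ∈ (if (restr r b S).Nonempty then models r (restr r b S) (b :: w)
        else []) ↔ ∃ v : List ℕ, v.length = r ∧ (∀ b ∈ v, b ≤ 1) ∧ y = (v ++ [b]) ++ w ∧
          ∃ c ∈ S, Sat (r + 1) c (v ++ [b]) := by
      intro b hb
      have hsat : ∀ v : List ℕ, v.length = r → ((∃ c ∈ S, Sat (r + 1) c (v ++ [b])) ↔
          ∃ c ∈ restr r b S, Sat r c v) := by
        rintro v rfl
        simp only [Sat, mem_restr]
        have h1 : (v ++ [b]).getD v.length 0 = b := by simp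
        have h2 : ∀ c, Sat v.length c (v ++ [b]) ↔ Sat v.length c v := fun c =>
          sat_congr fun i hi => by simp [List.getD_eq_getElem?_getD, List.getElem?_append_left hi]
        simp only [h1, h2]
        constructor
        · rintro ⟨c, hc, h, h'⟩; exact ⟨_, ⟨c, hc, h, rfl⟩, h'⟩
        · rintro ⟨_, ⟨c, hc, h, rfl⟩, h'⟩; exact ⟨c, hc, h, h'⟩
      split_ifs with hne
      · rw [ih hne]
        refine exists_congr fun v => and_congr_right fun hv => and_congr_right fun _ => ?_
        rw [hsat v hv]
        simp
      · simp only [List.not_mem_nil, false_iff]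
        rintro ⟨v, hv, -, -, h⟩
        obtain ⟨c, hc, -⟩ := (hsat v hv).1 h
        exact hne ⟨c, hc⟩
    rw [models, List.mem_append, key 0 (by omega), key 1 le_rfl]
    constructor
    · rintro (⟨v, hv, hb, h⟩ | ⟨v, hv, hb, h⟩)
      · exact ⟨v ++ [0], by simp [hv], by simpa [or_imp, forall_and] using hb, h⟩
      · exact ⟨v ++ [1], by simp [hv], by simpa [or_imp, forall_and] using hb, h⟩
    · rintro ⟨v, hv, hb, h⟩
      have hne : v ≠ [] := by rintro rfl; simp at hv
      obtain ⟨v', b, rfl⟩ : ∃ v' b, v = v' ++ [b] :=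
        ⟨v.dropLast, v.getLast hne, (List.dropLast_append_getLast hne).symm⟩
      have hb1 : b ≤ 1 := hb b (by simp)
      have hb' : ∀ b ∈ v', b ≤ 1 := fun a ha => hb a (by simp [ha])
      have hv' : v'.length = r := by simpa using hv
      interval_cases b
      · exact .inl ⟨v', hv', hb', h⟩
      · exact .inr ⟨v', hv', hb', h⟩

theorem exists_of_mem_models {r : ℕ} {S : Finset ℕ} {w y : List ℕ} (h : y ∈ models r S w) :
    ∃ v : List ℕ, v.length = r ∧ y = v ++ w := by
  induction r generalizing S w with
  | zero => exact ⟨[], rfl, by simpa [models] using h⟩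
  | succ r ih =>
    rw [models, List.mem_append] at h
    have key : ∀ b, y ∈ (if (restr r b S).Nonempty then models r (restr r b S) (b :: w)
        else []) → ∃ v : List ℕ, v.length = r + 1 ∧ y = v ++ w := by
      intro b hb
      split_ifs at hb
      · obtain ⟨v, hv, rfl⟩ := ih hb
        exact ⟨v ++ [b], by simp [hv], by simp⟩
      · simp at hb
    exact h.elim (key 0) (key 1)

/-- Words from the two branches differ in the letter in front of `w`. -/
theorem nodup_models (r : ℕ) (S : Finset ℕ) (w : List ℕ) : (models r S w).Nodup := by
  induction r generalizing S w with
  | zero => simp [models]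
  | succ r ih =>
    rw [models, List.nodup_append']
    refine ⟨by split_ifs <;> simp [ih], by split_ifs <;> simp [ih], ?_⟩
    intro y h0 h1
    split_ifs at h0 h1
    all_goals first
      | exact absurd h0 List.not_mem_nil
      | exact absurd h1 List.not_mem_nil
      | skip
    obtain ⟨v, hv, rfl⟩ := exists_of_mem_models h0
    obtain ⟨v', hv', h⟩ := exists_of_mem_models h1
    have := (List.append_inj h (by rw [hv, hv'])).2
    simp at this

/-! ### Counting -/

/-- The weight of a set of terms: a term of width `j` weighs `2 ^ r * (x / 2) ^ j`. -/
noncomputable def weight (x : ℝ) (r : ℕ) (S : Finset ℕ) : ℝ :=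
  ∑ c ∈ S, 2 ^ r * (x / 2) ^ width r c

/-- Removing the top digit is injective on codes with a common top digit. Merging can only identify
terms with different top digits, so each digit class separately is bounded by the child's weight. -/
theorem weight_le_restr {x : ℝ} (h0 : 0 ≤ x) (r b d : ℕ) (S : Finset ℕ) (hd : Compat b d) :
    ∑ c ∈ S.filter (fun c => c / 3 ^ r = d), 2 ^ r * (x / 2) ^ width r (c % 3 ^ r) ≤
      weight x r (restr r b S) := by
  have hinj : Set.InjOn (· % 3 ^ r) (S.filter fun c => c / 3 ^ r = d : Finset ℕ) := by
    intro a ha a' ha' h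
    simp only [coe_filter, Set.mem_ofPred_eq] at ha ha' h
    rw [← Nat.div_add_mod a (3 ^ r), ← Nat.div_add_mod a' (3 ^ r), ha.2, ha'.2, h]
  rw [← Finset.sum_image (f := fun c => 2 ^ r * (x / 2) ^ width r c) hinj]
  refine Finset.sum_le_sum_of_subset_of_nonneg ?_ fun _ _ _ => by positivity
  refine Finset.image_subset_image fun c hc => ?_
  simp only [mem_filter] at hc ⊢
  exact ⟨hc.1, hc.2 ▸ hd⟩

/-- Let `a₀`, `a₁`, `a₂` be the level-`r` weights of the three digit classes. The weight at level `r
+ 1` is `2 * a₀ + x * a₁ + x * a₂`. The child weights `w₀`, `w₁` satisfy `a₀, a₁ ≤ w₀` and `a₀, a₂ ≤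
w₁`. Splitting `2 * a₀` between both children gives the bound. -/
theorem weight_succ_le {x : ℝ} (h0 : 0 ≤ x) (r : ℕ) (S : Finset ℕ)
    (hS : ∀ c ∈ S, c < 3 ^ (r + 1)) :
    weight x (r + 1) S ≤ (1 + x) * (weight x r (restr r 0 S) + weight x r (restr r 1 S)) := by
  set f : ℕ → ℝ := fun c => 2 ^ r * (x / 2) ^ width r (c % 3 ^ r) with hf
  have hdig : ∀ c ∈ S, c / 3 ^ r ∈ range 3 := fun c hc => by
    rw [mem_range, Nat.div_lt_iff_lt_mul (by positivity)]
    have := hS c hc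
    rw [pow_succ] at this
    omega
  have h1 : weight x (r + 1) S = ∑ d ∈ range 3, ∑ c ∈ S.filter (fun c => c / 3 ^ r = d),
      2 ^ (r + 1) * (x / 2) ^ width (r + 1) c := (sum_fiberwise_of_maps_to hdig _).symm
  -- The extra variable doubles `2 ^ r`; a nonzero digit also contributes `x / 2`, so the net factor
  -- is `2` or `x`.
  have h2 : ∀ d, ∑ c ∈ S.filter (fun c => c / 3 ^ r = d), 2 ^ (r + 1) * (x / 2) ^ width (r + 1) c
      = (if d = 0 then 2 else x) * ∑ c ∈ S.filter (fun c => c / 3 ^ r = d), f c := by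
    intro d
    rw [mul_sum]
    refine sum_congr rfl fun c hc => ?_
    simp only [mem_filter] at hc
    simp only [hf, width, hc.2]
    split_ifs
    · ring
    · ring
  rw [h1]
  simp only [h2, sum_range_succ, sum_range_zero]
  have a0 := weight_le_restr h0 r 0 0 S (.inl rfl)
  have a1 := weight_le_restr h0 r 1 0 S (.inl rfl)
  have b0 := weight_le_restr h0 r 0 1 S (.inr rfl)
  have b1 := weight_le_restr h0 r 1 2 S (.inr rfl)
  change ∑ c ∈ S.filter (fun c => c / 3 ^ r = 0), f c ≤ _ at a0 a1
  change ∑ c ∈ S.filter (fun c => c / 3 ^ r = 1), f c ≤ _ at b0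
  change ∑ c ∈ S.filter (fun c => c / 3 ^ r = 2), f c ≤ _ at b1
  rw [if_pos trivial, if_neg one_ne_zero, if_neg two_ne_zero]
  have b0' := mul_le_mul_of_nonneg_left b0 h0
  have b1' := mul_le_mul_of_nonneg_left b1 h0
  linarith

theorem lt_of_mem_restr {r b c : ℕ} {S : Finset ℕ} (h : c ∈ restr r b S) : c < 3 ^ r := by
  obtain ⟨d, -, -, rfl⟩ := mem_restr.1 h
  exact Nat.mod_lt _ (by positivity)

/-- Each level contributes one factor `1 + x`. At level 0 the only possible code is 0, so the weight
is at most 1. -/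
theorem weight_le {x : ℝ} (h0 : 0 ≤ x) (r : ℕ) (S : Finset ℕ) (hS : ∀ c ∈ S, c < 3 ^ r) :
    weight x r S ≤ (1 + x) ^ r * numModels r S := by
  induction r generalizing S with
  | zero =>
    have : S.card ≤ 1 := by
      refine card_le_one.2 fun a ha b hb => ?_
      have := hS a ha; have := hS b hb
      simp at *; omega
    simpa [weight, width, numModels] using this
  | succ r ih =>
    have key : ∀ b, weight x r (restr r b S) ≤ (1 + x) ^ r *
        (if (restr r b S).Nonempty then numModels r (restr r b S) else 0 : ℕ) := by
      intro b
      split_ifs with h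
      · exact ih _ fun c hc => lt_of_mem_restr hc
      · simp [not_nonempty_iff_eq_empty.1 h, weight]
    refine (weight_succ_le h0 r S hS).trans ?_
    rw [numModels, Nat.cast_add, pow_succ', mul_assoc]
    refine mul_le_mul_of_nonneg_left ?_ (by positivity)
    rw [mul_add]
    exact add_le_add (key 0) (key 1)

theorem width_restr_le {r b k : ℕ} {S : Finset ℕ} (hS : ∀ c ∈ S, width (r + 1) c ≤ k) :
    ∀ c ∈ restr r b S, width r c ≤ k := by
  intro c hc
  obtain ⟨d, hd, -, rfl⟩ := mem_restr.1 hc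
  have := hS d hd
  rw [width] at this
  omega

/-- `m` terms of width at most `k` over `r` variables have at least
`m * ((1 + x) / 2) ^ (-r) * (x / 2) ^ k` models. -/
theorem card_le_numModels {x : ℝ} (h0 : 0 ≤ x) (h1 : x ≤ 1) {r k : ℕ} {S : Finset ℕ}
    (hS : ∀ c ∈ S, c < 3 ^ r) (hk : ∀ c ∈ S, width r c ≤ k) :
    (S.card : ℝ) * (x / 2) ^ k ≤ ((1 + x) / 2) ^ r * numModels r S := by
  have h2 : (S.card : ℝ) * (2 ^ r * (x / 2) ^ k) ≤ weight x r S := by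
    rw [weight, ← nsmul_eq_mul]
    refine card_nsmul_le_sum _ _ _ fun c hc => ?_
    exact mul_le_mul_of_nonneg_left
      (pow_le_pow_of_le_one (by positivity) (by linarith) (hk c hc)) (by positivity)
  have h3 := h2.trans (weight_le h0 r S hS)
  have h4 : (0 : ℝ) < 2 ^ r := by positivity
  rw [div_pow (1 + x), div_mul_eq_mul_div, le_div_iff₀ h4]
  linarith

/-- The total cost of the search: a node with `r` variables and `m` terms costs
`(r + 2) ^ 2 * (m + 1)`. -/
def searchCost : ℕ → Finset ℕ → ℕ
  | 0, S => 4 * (S.card + 1)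
  | r + 1, S => (r + 3) ^ 2 * (S.card + 1) +
    (if (restr r 0 S).Nonempty then searchCost r (restr r 0 S) else 0) +
      (if (restr r 1 S).Nonempty then searchCost r (restr r 1 S) else 0)

/-- Each node is charged to the models below it, using the lower bound on their number. The models
of a node are divided between its children, so every level is charged against the same total. -/
theorem searchCost_le {x : ℝ} (h0 : 0 < x) (h1 : x ≤ 1) {r k : ℕ} {S : Finset ℕ}
    (hne : S.Nonempty) (hS : ∀ c ∈ S, c < 3 ^ r) (hk : ∀ c ∈ S, width r c ≤ k) :
    (searchCost r S : ℝ) * (x / 2) ^ k ≤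
      (∑ i ∈ range (r + 1), 2 * ((i : ℝ) + 2) ^ 2 * ((1 + x) / 2) ^ i) * numModels r S := by
  have node : ∀ i : ℕ, ∀ S : Finset ℕ, S.Nonempty → (∀ c ∈ S, c < 3 ^ i) →
      (∀ c ∈ S, width i c ≤ k) → ((i : ℝ) + 2) ^ 2 * ((S.card : ℝ) + 1) * (x / 2) ^ k ≤
        2 * ((i : ℝ) + 2) ^ 2 * ((1 + x) / 2) ^ i * numModels i S := by
    intro i S hne hS hk
    have h2 := card_le_numModels h0.le h1 hS hk
    have h3 : (1 : ℝ) ≤ S.card := by exact_mod_cast hne.card_pos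
    -- A visited node has a term, so `m + 1 ≤ 2 * m`; this is the factor 2 in the sum.
    have h4 : ((S.card : ℝ) + 1) * (x / 2) ^ k ≤ 2 * (S.card * (x / 2) ^ k) := by
      have : 0 < (x / 2) ^ k := by positivity
      nlinarith
    calc _ = ((i : ℝ) + 2) ^ 2 * (((S.card : ℝ) + 1) * (x / 2) ^ k) := by ring
      _ ≤ ((i : ℝ) + 2) ^ 2 * (2 * (((1 + x) / 2) ^ i * numModels i S)) := by
        refine mul_le_mul_of_nonneg_left ?_ (by positivity)
        linarith
      _ = _ := by ring
  induction r generalizing S with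
  | zero =>
    have := node 0 S hne hS hk
    simp only [searchCost, zero_add, range_one, sum_singleton]
    push_cast at *
    linarith
  | succ r ih =>
    set T := ∑ i ∈ range (r + 1), 2 * ((i : ℝ) + 2) ^ 2 * ((1 + x) / 2) ^ i with hT
    have key : ∀ b, ((if (restr r b S).Nonempty then searchCost r (restr r b S) else 0 : ℕ) : ℝ) *
        (x / 2) ^ k ≤
        T * ((if (restr r b S).Nonempty then numModels r (restr r b S) else 0 : ℕ) : ℝ) := by
      intro b
      split_ifs with h
      · exact ih h (fun c hc => lt_of_mem_restr hc) (width_restr_le hk)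
      · simp
    have h2 := node (r + 1) S hne hS hk
    rw [sum_range_succ, ← hT, searchCost, add_mul]
    have e : (numModels (r + 1) S : ℝ) =
      ((if (restr r 0 S).Nonempty then numModels r (restr r 0 S) else 0 : ℕ) : ℝ) +
      ((if (restr r 1 S).Nonempty then numModels r (restr r 1 S) else 0 : ℕ) : ℝ) := by
      rw [numModels, Nat.cast_add]
    have k0 := key 0
    have k1 := key 1
    rw [Nat.cast_add, Nat.cast_add, add_mul, add_mul]
    have e2 : T * (numModels (r + 1) S : ℝ) = T *
      ((if (restr r 0 S).Nonempty then numModels r (restr r 0 S) else 0 : ℕ) : ℝ) + T *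
      ((if (restr r 1 S).Nonempty then numModels r (restr r 1 S) else 0 : ℕ) : ℝ) := by
      rw [e, mul_add]
    rw [e2]
    push_cast at h2 ⊢
    push_cast at k0 k1
    have e3 : ((r : ℝ) + 3) ^ 2 = ((r : ℝ) + 1 + 2) ^ 2 := by ring
    rw [e3]
    linarith

/-- Search and parsing together take time `O(2 ^ (3 k / 2))` per model. -/
theorem exists_time_bound : ∃ C : ℝ, 0 ≤ C ∧ ∀ (r k : ℕ) (S : Finset ℕ), S.Nonempty →
    (∀ c ∈ S, c < 3 ^ r) → (∀ c ∈ S, width r c ≤ k) →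
    (searchCost r S : ℝ) + ((r : ℝ) + 2) ^ 3 * (S.card + 1) ≤
      C * (2 : ℝ) ^ (3 * (k : ℝ) / 2) * numModels r S := by
  -- Summability over the levels needs `x < 1`; this value makes `2 / x` equal to `2 ^ (3 / 2)`.
  set x : ℝ := (√2)⁻¹ with hx
  have hs : (0 : ℝ) < √2 := by positivity
  have h0 : 0 < x := by positivity
  have hlt : x < 1 := inv_lt_one_of_one_lt₀ (by rw [Real.lt_sqrt] <;> norm_num)
  set ρ : ℝ := (1 + x) / 2 with hρ
  have hρ0 : 0 < ρ := by positivity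
  have hρ1 : ‖ρ‖ < 1 := by rw [Real.norm_of_nonneg hρ0.le]; rw [hρ]; linarith
  have hsum : ∀ d : ℕ, Summable fun i : ℕ => ((i : ℝ) + 2) ^ d * ρ ^ i := by
    intro d
    have h := (summable_pow_mul_geometric_of_norm_lt_one d hρ1)
    -- The series of `i ^ d * ρ ^ i`, shifted by two places and divided by `ρ ^ 2`.
    have h' := ((summable_nat_add_iff 2).2 h).mul_left ((ρ ^ 2)⁻¹)
    refine h'.congr fun i => ?_
    push_cast
    field_simp
    ring
  have hle : ∀ (d : ℕ) (r : ℕ), ∑ i ∈ range r, ((i : ℝ) + 2) ^ d * ρ ^ i ≤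
      ∑' i : ℕ, ((i : ℝ) + 2) ^ d * ρ ^ i := fun d r =>
    (hsum d).sum_le_tsum _ fun i _ => by positivity
  have hle' : ∀ (d : ℕ) (r : ℕ), ((r : ℝ) + 2) ^ d * ρ ^ r ≤
      ∑' i : ℕ, ((i : ℝ) + 2) ^ d * ρ ^ i := fun d r =>
    (hsum d).le_tsum r fun i _ => by positivity
  set A := ∑' i : ℕ, ((i : ℝ) + 2) ^ 2 * ρ ^ i
  set B := ∑' i : ℕ, ((i : ℝ) + 2) ^ 3 * ρ ^ i
  have hpow : ∀ k : ℕ, (x / 2) ^ k * (2 : ℝ) ^ (3 * (k : ℝ) / 2) = 1 := by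
    intro k
    have e : (2 : ℝ) ^ (3 * (k : ℝ) / 2) = (2 * √2) ^ k := by
      rw [Real.sqrt_eq_rpow, ← Real.rpow_natCast (2 * 2 ^ (1 / 2 : ℝ)),
        show (2 : ℝ) * 2 ^ (1 / 2 : ℝ) = 2 ^ (3 / 2 : ℝ) by
          rw [← Real.rpow_one_add' (by norm_num) (by norm_num)]; norm_num,
        ← Real.rpow_mul (by norm_num)]
      congr 1; ring
    rw [e, ← mul_pow, hx]
    rw [show (√2)⁻¹ / 2 * (2 * √2) = 1 by field_simp, one_pow]
  have hA : 0 ≤ A := tsum_nonneg fun i => by positivity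
  have hB : 0 ≤ B := tsum_nonneg fun i => by positivity
  refine ⟨2 * A + 2 * B, by positivity, fun r k S hne hS hk => ?_⟩
  have h1 := searchCost_le h0 hlt.le hne hS hk
  have h2 := card_le_numModels h0.le hlt.le hS hk
  have h3 : (1 : ℝ) ≤ S.card := by exact_mod_cast hne.card_pos
  have hM : (0 : ℝ) ≤ numModels r S := by positivity
  have hX : 0 < (x / 2) ^ k := by positivity
  have hY : 0 < (2 : ℝ) ^ (3 * (k : ℝ) / 2) := by positivity
  have h4 : (∑ i ∈ range (r + 1), 2 * ((i : ℝ) + 2) ^ 2 * ρ ^ i) ≤ 2 * A := by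
    have := hle 2 (r + 1)
    simp only [mul_assoc, ← mul_sum] at this ⊢
    linarith
  -- Parsing is charged like one node of level `r`; its cubic factor is absorbed by `ρ ^ r`.
  have h5 : ((r : ℝ) + 2) ^ 3 * (S.card + 1) * (x / 2) ^ k ≤ 2 * B * numModels r S := by
    have h6 : ((S.card : ℝ) + 1) * (x / 2) ^ k ≤ 2 * (ρ ^ r * numModels r S) := by nlinarith
    calc _ = ((r : ℝ) + 2) ^ 3 * (((S.card : ℝ) + 1) * (x / 2) ^ k) := by ring
      _ ≤ ((r : ℝ) + 2) ^ 3 * (2 * (ρ ^ r * numModels r S)) := by gcongr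
      _ = 2 * (((r : ℝ) + 2) ^ 3 * ρ ^ r) * numModels r S := by ring
      _ ≤ _ := by gcongr; exact hle' 3 r
  have h7 := mul_le_mul_of_nonneg_right h4 hM
  have h8 : ((searchCost r S : ℝ) + ((r : ℝ) + 2) ^ 3 * (S.card + 1)) * (x / 2) ^ k ≤
      (2 * A + 2 * B) * numModels r S := by rw [add_mul, add_mul]; linarith
  have h9 := mul_le_mul_of_nonneg_right h8 hY.le
  rw [mul_assoc, hpow k, mul_one] at h9
  linarith

end DNFEnum
namespace DNFEnum
open RAM Finset

/-! ### Construction of the children of a node -/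

/-- Split the code `R 10` into its top digit and the rest; `R 13 ≠ 0` if the digit is compatible
with the bit `R 33`. -/
def digitStep : Cmd :=
  .prim (.sub 12 34 10) ;;
  .ite 12 (.prim (.const 13 1))
    (.prim (.sub 10 10 34) ;; .prim (.sub 12 34 10) ;;
      .ite 12 (.prim (.const 13 1) ;; .prim (.sub 13 13 33))
        (.prim (.sub 10 10 34) ;; .prim (.copy 13 33)))

/-- Append the code `R 10` to the list of length `R 11` unless it is there. -/
def insertStep : Cmd :=
  .prim (.add 12 34 10) ;; aload 14 3 12 ;; .prim (.add 15 34 14) ;; aload 16 2 15 ;;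
  .prim (.sub 17 16 10) ;; .prim (.sub 18 10 16) ;; .prim (.add 17 17 18) ;;
  .prim (.const 4 1) ;; .prim (.add 18 14 4) ;; .prim (.sub 18 18 11) ;; .prim (.add 17 17 18) ;;
  .ite 17
    (astore 3 12 11 ;; .prim (.add 15 34 11) ;; astore 2 15 10 ;; .prim (.const 4 1) ;;
      .prim (.add 11 11 4))
    .skip

/-- `R 8` is the index of the next code in the parent's list and `R 9` the number of codes that
remain. -/
def buildStep : Cmd :=
  aload 10 2 8 ;; digitStep ;; .ite 13 insertStep .skip ;;
  .prim (.const 4 1) ;; .prim (.add 8 8 4) ;; .prim (.sub 9 9 4)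

/-- Build the list of the child of the node of level `R 32` for the bit `R 33`. -/
def build : Cmd :=
  aload 8 0 32 ;; aload 9 4 32 ;; .prim (.const 4 1) ;; .prim (.sub 35 32 4) ;; aload 34 0 35 ;;
  .prim (.const 11 0) ;; .loop 9 buildStep ;; astore 4 35 11

/-- There is no division: the digit is found by at most two subtractions of `q`. The compatibility
flag is `1` for digit 0, `1 - b` for digit 1 and `b` for digit 2. -/
theorem digitStep_spec {l q b : ℕ} {s : St} (hq : 0 < q) (hl : 400 * q ≤ 2 ^ l)
    (h34 : s.reg 34 = q) (h33 : s.reg 33 = b) (hb : b ≤ 1) (hc : s.reg 10 < 3 * q) :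
    wp l digitStep (fun s' => s'.reg 10 = s.reg 10 % q ∧
      (s'.reg 13 ≠ 0 ↔ Compat b (s.reg 10 / q)) ∧
      (∀ a, a ≠ 10 → a ≠ 12 → a ≠ 13 → s'.reg a = s.reg a) ∧ s'.inp = s.inp ∧ s'.out = s.out ∧
      s'.time ≤ s.time + 8) s := by
  set c := s.reg 10 with hc'
  have hd : c = q * (c / q) + c % q := (Nat.div_add_mod c q).symm
  have hm : c % q < q := Nat.mod_lt _ hq
  have hd3 : c / q < 3 := by rw [Nat.div_lt_iff_lt_mul hq]; exact hc
  simp only [digitStep, wp_seq, wp_ite, wp_const, wp_copy, wp_sub, Function.update_self,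
    Function.update_of_ne, ne_eq, Nat.reduceEqDiff, not_false_eq_true, St.tick, h34, h33,
    ← hc', Compat, true_and]
  generalize c / q = d at *
  generalize c % q = m at *
  interval_cases d
  · refine ⟨⟨by omega, by omega⟩, fun _ => ⟨by omega, by simp, ?_, by omega⟩,
      fun h => by omega⟩
    intro a h1 h2 h3
    simp [h2, h3]
  · refine ⟨⟨by omega, by omega⟩, fun h => by omega,
      fun h => ⟨⟨by omega, by omega⟩, ⟨by omega, by omega⟩, fun _ => ?_, fun h => by omega⟩⟩
    refine ⟨⟨by omega, by omega⟩, by omega, by omega, ?_, by omega⟩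
    intro a h1 h2 h3
    simp [h1, h2, h3]
  · refine ⟨⟨by omega, by omega⟩, fun h => by omega,
      fun h => ⟨⟨by omega, by omega⟩, ⟨by omega, by omega⟩, fun h => by omega, fun _ => ?_⟩⟩
    refine ⟨⟨by omega, by omega⟩, by omega, by omega, ?_, by omega⟩
    intro a h1 h2 h3
    simp [h1, h2, h3]

/-- With `p` the tabulated position of `c`, `R 17` becomes `|list[p] - c| + (p + 1 - k)`. It
vanishes iff `p < k` and the list holds `c` at `p`, that is, iff `c` is already listed. The table
may hold stale values, which this test sees through. The hypotheses `hpos` and `hlist` only keep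
such values small enough to be operands. -/
theorem insertStep_spec {l q c k : ℕ} {s : St} (hq : 0 < q) (hl : 400 * q ≤ 2 ^ l)
    (h34 : s.reg 34 = q) (h10 : s.reg 10 = c) (h11 : s.reg 11 = k) (hc : c < q) (hk : k ≤ q)
    (hpos : s.reg (addr 3 (q + c)) ≤ q + c)
    (hlist : s.reg (addr 2 (q + s.reg (addr 3 (q + c)))) ≤ q + s.reg (addr 3 (q + c))) :
    wp l insertStep (fun s' =>
      s'.reg 8 = s.reg 8 ∧ s'.reg 9 = s.reg 9 ∧ s'.inp = s.inp ∧ s'.out = s.out ∧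
      s'.time ≤ s.time + 50 ∧
      ((s.reg (addr 3 (q + c)) < k ∧ s.reg (addr 2 (q + s.reg (addr 3 (q + c)))) = c ∧
          s'.reg 11 = k ∧ ∀ a, 32 ≤ a → s'.reg a = s.reg a) ∨
        (¬ (s.reg (addr 3 (q + c)) < k ∧ s.reg (addr 2 (q + s.reg (addr 3 (q + c)))) = c) ∧
          s'.reg 11 = k + 1 ∧ ∀ a, 32 ≤ a → s'.reg a =
            Function.update (Function.update s.reg (addr 3 (q + c)) k) (addr 2 (q + k)) c a))) s := by
  set j := s.reg (addr 3 (q + c)) with hj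
  set e := s.reg (addr 2 (q + j)) with he
  simp only [insertStep, wp_seq, wp_ite, wp_const, wp_sub, wp_add, wp_skip, wp_aload, wp_astore,
    Function.update_self, Function.update_of_ne, ne_eq, not_false_eq_true, St.tick,
    Nat.reduceEqDiff, h34, h10, h11, OfNat.ofNat_ne_zero, OfNat.ofNat_ne_one,
    addr_eq_small, small_eq_addr, Nat.reduceLT, ← hj, ← he, true_and]
  refine ⟨by omega, by omega, by omega, by omega, by omega, by omega, by omega, by omega, by omega,
    by omega, fun h => ?_, fun h => ?_⟩
  · refine ⟨by omega, by omega, by omega, by omega, by omega,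
      .inr ⟨by omega, ?_⟩⟩
    intro a ha
    have : ∀ x < 32, a ≠ x := fun x hx => by omega
    simp [Function.update_apply, this]
  · refine ⟨by omega, .inl ⟨by omega, by omega, ?_⟩⟩
    intro a ha
    have : ∀ x < 32, a ≠ x := fun x hx => by omega
    simp [this]


theorem buildStep_spec {l q b k c a m : ℕ} {s : St} (hq : 0 < q) (hl : 400 * q ≤ 2 ^ l)
    (h34 : s.reg 34 = q) (h33 : s.reg 33 = b) (hb : b ≤ 1) (h11 : s.reg 11 = k) (hk : k ≤ q)
    (h8 : s.reg 8 = a) (ha : a < 9 * q) (h9 : s.reg 9 = m + 1) (hm : m < 9 * q)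
    (hc : s.reg (addr 2 a) = c) (hc3 : c < 3 * q)
    (hpos : ∀ i < 3 * q, s.reg (addr 3 i) ≤ i) (hlist : ∀ i < 3 * q, s.reg (addr 2 i) ≤ i) :
    wp l buildStep (fun s' =>
      s'.reg 8 = a + 1 ∧ s'.reg 9 = m ∧ s'.inp = s.inp ∧ s'.out = s.out ∧
      s'.time ≤ s.time + 70 ∧
      (((¬ Compat b (c / q) ∨ (s.reg (addr 3 (q + c % q)) < k ∧
          s.reg (addr 2 (q + s.reg (addr 3 (q + c % q)))) = c % q)) ∧
          s'.reg 11 = k ∧ ∀ a, 32 ≤ a → s'.reg a = s.reg a) ∨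
        (Compat b (c / q) ∧ ¬ (s.reg (addr 3 (q + c % q)) < k ∧
            s.reg (addr 2 (q + s.reg (addr 3 (q + c % q)))) = c % q) ∧
          s'.reg 11 = k + 1 ∧ ∀ a, 32 ≤ a → s'.reg a =
            Function.update (Function.update s.reg (addr 3 (q + c % q)) k)
              (addr 2 (q + k)) (c % q) a))) s := by
  have hm : c % q < q := Nat.mod_lt _ hq
  rw [buildStep, wp_seq, wp_aload (by decide), wp_seq]
  simp only [h8, hc]
  refine ⟨by omega, ?_⟩
  refine wp_mono (digitStep_spec (q := q) (b := b) hq hl ?_ ?_ hb ?_) ?_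
  · simp [h34]
  · simp [h33]
  · simp [hc3]
  rintro s₁ ⟨e10, e13, fr, ei, eo, et⟩
  simp only [Function.update_self] at e10 e13 ei eo et
  have fr' : ∀ x, x ≠ 0 → x ≠ 1 → x ≠ 10 → x ≠ 12 → x ≠ 13 → s₁.reg x = s.reg x := by
    intro x h0 h1 h2 h3 h4
    rw [fr x h2 h3 h4]
    simp [h0, h1, h2]
  have fr32 : ∀ x, 32 ≤ x → s₁.reg x = s.reg x := fun x hx =>
    fr' x (by omega) (by omega) (by omega) (by omega) (by omega)
  have fra : ∀ j i, s₁.reg (addr j i) = s.reg (addr j i) := fun j i =>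
    fr32 _ (by unfold addr; omega)
  rw [wp_seq, wp_ite]
  have fin : ∀ s₂ : St, s₂.reg 8 = a → s₂.reg 9 = m + 1 →
      wp l (.prim (.const 4 1) ;; .prim (.add 8 8 4) ;; .prim (.sub 9 9 4)) (fun s' =>
        s'.reg 8 = a + 1 ∧ s'.reg 9 = m ∧ s'.inp = s₂.inp ∧ s'.out = s₂.out ∧
        s'.time = s₂.time + 3 ∧ s'.reg 11 = s₂.reg 11 ∧
        ∀ a, 32 ≤ a → s'.reg a = s₂.reg a) s₂ := by
    intro s₂ g8 g9
    simp only [wp_seq, wp_const, wp_add, wp_sub, Function.update_self, Function.update_of_ne, ne_eq,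
      Nat.reduceEqDiff, not_false_eq_true, g8, g9]
    refine ⟨by omega, by omega, trivial, by omega, trivial, trivial, trivial, trivial, ?_⟩
    intro a ha
    have : ∀ x < 32, a ≠ x := fun x hx => by omega
    simp [this]
  refine ⟨fun h => ?_, fun h => ?_⟩
  · have hcomp := e13.1 h
    have g3 : (s₁.tick 1).reg (addr 3 (q + c % q)) = s.reg (addr 3 (q + c % q)) := fra _ _
    have p1 := hpos (q + c % q) (by omega)
    refine wp_mono (insertStep_spec (q := q) (c := c % q) (k := k) hq hl ?_ e10 ?_ hm hk ?_ ?_) ?_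
    · exact (fr32 34 (by omega)).trans h34
    · exact (fr' 11 (by omega) (by omega) (by omega) (by omega) (by omega)).trans h11
    · rw [g3]; exact p1
    · rw [g3]; exact (fra _ _).trans_le (hlist _ (by omega))
    rintro s₂ ⟨q8, q9, qi, qo, qt, hcase⟩
    have q8' : s₂.reg 8 = a := q8.trans ((fr' 8 (by omega) (by omega) (by omega) (by omega)
      (by omega)).trans h8)
    have q9' : s₂.reg 9 = m + 1 := q9.trans ((fr' 9 (by omega) (by omega) (by omega) (by omega)
      (by omega)).trans h9)
    refine wp_mono (fin (s₂.tick 1) q8' q9') ?_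
    rintro s₃ ⟨r8, r9, ri, ro, rt, r11, r32⟩
    refine ⟨r8, r9, ri.trans (qi.trans ei), ro.trans (qo.trans eo), ?_, ?_⟩
    · simp only [St.tick] at rt qt; omega
    rw [g3] at hcase
    have g2 : (s₁.tick 1).reg (addr 2 (q + s.reg (addr 3 (q + c % q)))) =
      s.reg (addr 2 (q + s.reg (addr 3 (q + c % q)))) := fra _ _
    rw [g2] at hcase
    rcases hcase with ⟨c1, c2, c3, c4⟩ | ⟨c1, c3, c4⟩
    · exact .inl ⟨.inr ⟨c1, c2⟩, r11.trans c3, fun x hx =>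
        (r32 x hx).trans ((c4 x hx).trans (fr32 x hx))⟩
    · refine .inr ⟨hcomp, c1, r11.trans c3, fun x hx => (r32 x hx).trans ((c4 x hx).trans ?_)⟩
      have := fr32 x hx
      simp only [Function.update_apply]
      split_ifs <;> first | rfl | exact this
  · have hcomp : ¬ Compat b (c / q) := fun h' => e13.2 h' h
    rw [wp_skip]
    refine wp_mono (fin (s₁.tick 1) ?_ ?_) ?_
    · exact (fr' 8 (by omega) (by omega) (by omega) (by omega) (by omega)).trans h8
    · exact (fr' 9 (by omega) (by omega) (by omega) (by omega) (by omega)).trans h9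
    rintro s₃ ⟨r8, r9, ri, ro, rt, r11, r32⟩
    refine ⟨r8, r9, ri.trans ei, ro.trans eo, ?_, .inl ⟨.inl hcomp, ?_, ?_⟩⟩
    · simp only [St.tick] at rt; omega
    · exact r11.trans ((fr' 11 (by omega) (by omega) (by omega) (by omega) (by omega)).trans h11)
    · exact fun x hx => (r32 x hx).trans (fr32 x hx)

/-- The codes in `S` are listed from position `q` of array `2` on. -/
def Lists (R : ℕ → ℕ) (q : ℕ) (S : Finset ℕ) : Prop :=
  ((List.range S.card).map fun t => R (addr 2 (q + t))).toFinset = S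

theorem Lists.mem_iff {R : ℕ → ℕ} {q c : ℕ} {S : Finset ℕ} (h : Lists R q S) :
    c ∈ S ↔ ∃ t < S.card, R (addr 2 (q + t)) = c := by
  conv_lhs => rw [← h]
  simp

theorem Lists.congr {R R' : ℕ → ℕ} {q : ℕ} {S : Finset ℕ} (h : Lists R q S)
    (hR : ∀ t < S.card, R' (addr 2 (q + t)) = R (addr 2 (q + t))) : Lists R' q S := by
  unfold Lists at *
  conv_rhs => rw [← h]
  congr 1
  exact List.map_congr_left fun t ht => hR t (List.mem_range.1 ht)

/-- The codes in `S` are listed, and array `3` holds their positions in the list. -/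
structure Building (R : ℕ → ℕ) (q : ℕ) (S : Finset ℕ) : Prop where
  lists : Lists R q S
  pos : ∀ t < S.card, R (addr 3 (q + R (addr 2 (q + t)))) = t
  lt : ∀ c ∈ S, c < q

theorem Building.card_le {R : ℕ → ℕ} {q : ℕ} {S : Finset ℕ} (h : Building R q S) : S.card ≤ q := by
  simpa using card_le_card (fun c hc => mem_range.2 (h.lt c hc) : S ⊆ range q)

/-- This is why the position table needs no initialisation: an arbitrary entry for an absent `c`
cannot point to a listed occurrence of `c`. -/
theorem Building.mem_iff {R : ℕ → ℕ} {q c : ℕ} {S : Finset ℕ} (h : Building R q S) :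
    c ∈ S ↔ (R (addr 3 (q + c)) < S.card ∧ R (addr 2 (q + R (addr 3 (q + c)))) = c) := by
  constructor
  · intro hc
    obtain ⟨t, ht, rfl⟩ := h.lists.mem_iff.1 hc
    rw [h.pos t ht]
    exact ⟨ht, rfl⟩
  · rintro ⟨h1, h2⟩
    exact h.lists.mem_iff.2 ⟨_, h1, h2⟩

theorem Building.insert {R R' : ℕ → ℕ} {q c : ℕ} {S : Finset ℕ} (h : Building R q S) (hc : c < q)
    (hS : c ∉ S) (hR : ∀ a, 32 ≤ a → R' a =
      Function.update (Function.update R (addr 3 (q + c)) S.card) (addr 2 (q + S.card)) c a) :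
    Building R' q (insert c S) := by
  have e2 : ∀ t, R' (addr 2 (q + t)) = if t = S.card then c else R (addr 2 (q + t)) := by
    intro t
    rw [hR _ (by unfold addr; omega)]
    simp [Function.update_apply, addr_inj]
  have e3 : ∀ t, R' (addr 3 (q + t)) = if t = c then S.card else R (addr 3 (q + t)) := by
    intro t
    rw [hR _ (by unfold addr; omega)]
    simp [Function.update_apply, addr_inj]
  have hlt : ∀ t < S.card, R' (addr 2 (q + t)) = R (addr 2 (q + t)) := fun t ht => by
    rw [e2, if_neg ht.ne]
  refine ⟨?_, ?_, ?_⟩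
  · have h1 := h.lists.congr hlt
    unfold Lists at *
    rw [card_insert_of_notMem hS, List.range_succ, List.map_append, List.toFinset_append, h1]
    ext x
    simp [e2]
  · intro t ht
    rw [card_insert_of_notMem hS] at ht
    rcases Nat.lt_succ_iff_lt_or_eq.1 ht with ht | rfl
    · rw [hlt t ht, e3, if_neg, h.pos t ht]
      rintro rfl
      exact hS (h.lists.mem_iff.2 ⟨t, ht, rfl⟩)
    · rw [e2, if_pos rfl, e3, if_pos rfl]
  · intro x hx
    rcases mem_insert.1 hx with rfl | hx
    · exact hc
    · exact h.lt x hx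

theorem Building.congr {R R' : ℕ → ℕ} {q : ℕ} {S : Finset ℕ} (h : Building R q S)
    (hR : ∀ a, 32 ≤ a → R' a = R a) : Building R' q S := by
  have e : ∀ j i, R' (addr j i) = R (addr j i) := fun j i => hR _ (by unfold addr; omega)
  exact ⟨h.lists.congr fun t _ => e _ _, fun t ht => by rw [e, e, h.pos t ht], h.lt⟩

/-- The registers that the construction of a child of size `q` leaves alone. -/
def BuildFrame (q : ℕ) (R R' : ℕ → ℕ) : Prop :=
  ∀ a, 32 ≤ a → (∀ i, q ≤ i → i < 2 * q → a ≠ addr 2 i ∧ a ≠ addr 3 i) → R' a = R a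

/-- The parent's codes lie from index `3 * q` on, while the loop writes only at indices in `[q, 2 *
q)`, so the list being read is never disturbed. -/
theorem buildLoop_spec {l q b : ℕ} (hq : 0 < q) (hl : 400 * q ≤ 2 ^ l) (hb : b ≤ 1) (cs : List ℕ)
    {a : ℕ} {s : St} {S : Finset ℕ}
    (h34 : s.reg 34 = q) (h33 : s.reg 33 = b) (h11 : s.reg 11 = S.card)
    (h8 : s.reg 8 = a) (ha : 3 * q ≤ a) (ha' : a + cs.length ≤ 9 * q) (h9 : s.reg 9 = cs.length)
    (hcs : ∀ (t : ℕ) (h : t < cs.length), s.reg (addr 2 (a + t)) = cs[t])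
    (hlt : ∀ c ∈ cs, c < 3 * q) (hpos : ∀ i < 3 * q, s.reg (addr 3 i) ≤ i)
    (hlist : ∀ i < 3 * q, s.reg (addr 2 i) ≤ i) (hB : Building s.reg q S) :
    wp l (.loop 9 buildStep) (fun s' =>
      s'.inp = s.inp ∧ s'.out = s.out ∧ s'.time ≤ s.time + 72 * cs.length + 1 ∧
      s'.reg 11 =
        (S ∪ (cs.toFinset.filter fun c => Compat b (c / q)).image (· % q)).card ∧
      Building s'.reg q (S ∪ (cs.toFinset.filter fun c => Compat b (c / q)).image (· % q)) ∧
      (∀ i < 3 * q, s'.reg (addr 3 i) ≤ i) ∧ (∀ i < 3 * q, s'.reg (addr 2 i) ≤ i) ∧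
      BuildFrame q s.reg s'.reg) s := by
  induction cs generalizing a s S with
  | nil =>
    refine wp_loop_done h9 ?_
    simp only [List.toFinset_nil, filter_empty, image_empty, union_empty]
    exact ⟨rfl, rfl, by simp [St.tick], h11, hB, hpos, hlist, fun _ _ _ => rfl⟩
  | cons c cs ih =>
    have hlen : (c :: cs).length = cs.length + 1 := rfl
    rw [hlen] at ha' h9
    refine wp_loop_step (by omega) ?_
    have hc : s.reg (addr 2 a) = c := hcs 0 (by simp)
    have hm : c % q < q := Nat.mod_lt _ hq
    refine wp_mono (buildStep_spec (s := s.tick 1) (a := a) (m := cs.length) hq hl h34 h33 hb h11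
      hB.card_le h8 (by omega) h9 (by omega) hc (hlt c (by simp)) hpos hlist) ?_
    rintro s₁ ⟨e8, e9, ei, eo, et, hcase⟩
    -- `S₁` is `S`, with `c % q` adjoined if the code is compatible and its remainder is new.
    obtain ⟨S₁, hS₁, g11, gB, gpos, glist, gfr⟩ : ∃ S₁ : Finset ℕ,
        S ∪ ((c :: cs).toFinset.filter fun c => Compat b (c / q)).image (· % q) =
          S₁ ∪ (cs.toFinset.filter fun c => Compat b (c / q)).image (· % q) ∧
        s₁.reg 11 = S₁.card ∧ Building s₁.reg q S₁ ∧ (∀ i < 3 * q, s₁.reg (addr 3 i) ≤ i) ∧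
        (∀ i < 3 * q, s₁.reg (addr 2 i) ≤ i) ∧ BuildFrame q s.reg s₁.reg := by
      have hmem : c % q ∈ S ↔ _ := hB.mem_iff (c := c % q)
      rcases hcase with ⟨c1, c2, c3⟩ | ⟨c1, c2, c3, c4⟩
      · refine ⟨S, ?_, c2, hB.congr c3, ?_, ?_, fun x hx _ => c3 x hx⟩
        · rw [List.toFinset_cons, filter_insert]
          split_ifs with hco
          · have : c % q ∈ S := hmem.2 (c1.resolve_left (not_not.2 hco))
            rw [image_insert, union_insert, ← insert_union, insert_eq_of_mem this]
          · rfl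
        · intro i hi; rw [c3 _ (by unfold addr; omega)]; exact hpos i hi
        · intro i hi; rw [c3 _ (by unfold addr; omega)]; exact hlist i hi
      · have hnot : c % q ∉ S := fun h => c2 (hmem.1 h)
        have hB' := hB.insert hm hnot c4
        have hlt' : S.card < q := by
          have := hB'.card_le; rw [card_insert_of_notMem hnot] at this; omega
        refine ⟨insert (c % q) S, ?_, ?_, hB', ?_, ?_, ?_⟩
        · rw [List.toFinset_cons, filter_insert, if_pos c1, image_insert, union_insert,
            insert_union]
        · rw [card_insert_of_notMem hnot]; exact c3
        · intro i hi
          rw [c4 _ (by unfold addr; omega)]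
          have := hpos i hi
          simp only [Function.update_apply, addr_inj, Nat.reduceLT, Nat.reduceEqDiff, false_and,
            if_false, true_and]
          split_ifs with h
          · omega
          · exact this
        · intro i hi
          rw [c4 _ (by unfold addr; omega)]
          have := hlist i hi
          simp only [Function.update_apply, addr_inj, Nat.reduceLT, Nat.reduceEqDiff, false_and,
            if_false, true_and]
          split_ifs with h
          · omega
          · exact this
        · intro x hx hx'
          rw [c4 x hx, Function.update_of_ne (hx' _ (by omega) (by omega)).1,
            Function.update_of_ne (hx' _ (by omega) (by omega)).2]
          rfl
    rw [hS₁]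
    have ga : ∀ i, 2 * q ≤ i → s₁.reg (addr 2 i) = s.reg (addr 2 i) := fun i hi =>
      gfr _ (by unfold addr; omega) fun i' h1 h2 => by unfold addr; omega
    have gs : ∀ x, 32 ≤ x → x < 64 → s₁.reg x = s.reg x := fun x h1 h2 =>
      gfr x h1 fun i' _ _ => by unfold addr; omega
    refine wp_mono (ih (a := a + 1) (s := s₁.tick 1) (S := S₁) ((gs 34 (by omega) (by omega)).trans h34)
      ((gs 33 (by omega) (by omega)).trans h33) g11 e8 (by omega) (by omega) e9 ?_
      (fun x hx => hlt x (by simp [hx])) gpos glist gB) ?_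
    · intro t ht
      have h1 := hcs (t + 1) (by simpa using ht)
      have h2 := ga (a + 1 + t) (by omega)
      rw [show a + (t + 1) = a + 1 + t by omega] at h1
      exact h2.trans (by simpa using h1)
    · rintro s₂ ⟨r1, r2, r3, r4, r5, r6, r7, r8⟩
      refine ⟨r1.trans ei, r2.trans eo, ?_, r4, r5, r6, r7, fun x hx hx' =>
        (r8 x hx hx').trans (gfr x hx hx')⟩
      simp only [St.tick, hlen] at r3 et ⊢
      omega

end DNFEnum
namespace DNFEnum
open RAM Finset

/-- Address of the cell for the value of the first variable. -/
def base (n : ℕ) : ℕ := 64 + 8 * 3 ^ (n + 1)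

/-- The tables and pointers that the search relies on. -/
structure Inv (n : ℕ) (R : ℕ → ℕ) : Prop where
  pow : ∀ i ≤ n, R (addr 0 i) = 3 ^ i
  cell : ∀ i < n, R (addr 1 i) = base n + i
  list : ∀ i < 3 ^ (n + 1), R (addr 2 i) ≤ i
  pos : ∀ i < 3 ^ (n + 1), R (addr 3 i) ≤ i
  first : R 36 = base n
  last : R 37 + 1 = base n + n

/-- The entries `0, …, n` of the two tables are among the first `3 ^ (n + 1)` entries, since `n < 3
^ n`. -/
theorem Inv.congr {n : ℕ} {R R' : ℕ → ℕ} (h : Inv n R) (h36 : R' 36 = R 36) (h37 : R' 37 = R 37)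
    (hR : ∀ j < 4, ∀ i < 3 ^ (n + 1), R' (addr j i) = R (addr j i)) : Inv n R' := by
  have hn : n < 3 ^ n := n.lt_pow_self (by norm_num)
  have hn' : 3 ^ (n + 1) = 3 * 3 ^ n := pow_succ' 3 n
  refine ⟨fun i hi => ?_, fun i hi => ?_, fun i hi => ?_, fun i hi => ?_, h36.trans h.first, ?_⟩
  · rw [hR 0 (by norm_num) i (by omega), h.pow i hi]
  · rw [hR 1 (by norm_num) i (by omega), h.cell i hi]
  · rw [hR 2 (by norm_num) i hi]; exact h.list i hi
  · rw [hR 3 (by norm_num) i hi]; exact h.pos i hi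
  · rw [h37, h.last]

/-- The terms of the current node of level `r` are those with codes in `S`. -/
structure Level (R : ℕ → ℕ) (r : ℕ) (S : Finset ℕ) : Prop where
  count : R (addr 4 r) = S.card
  lists : Lists R (3 ^ r) S
  lt : ∀ c ∈ S, c < 3 ^ r

theorem Level.card_le {R : ℕ → ℕ} {r : ℕ} {S : Finset ℕ} (h : Level R r S) : S.card ≤ 3 ^ r := by
  simpa using Finset.card_le_card (fun c hc => mem_range.2 (h.lt c hc) : S ⊆ range (3 ^ r))

/-- The list of level `r` fits into `[3 ^ r, 2 * 3 ^ r)` and that of level `r + 1` starts at `3 * 3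
^ r`, so the lists of all levels coexist in one array. Both the operand bound and the time depend on
`r`, not on `n`. -/
theorem build_spec {l n r b : ℕ} {s : St} {S : Finset ℕ} (hl : 400 * 3 ^ r ≤ 2 ^ l) (hr : r < n)
    (hb : b ≤ 1) (h32 : s.reg 32 = r + 1) (h33 : s.reg 33 = b) (hI : Inv n s.reg)
    (hS : Level s.reg (r + 1) S) :
    wp l build (fun s' => s'.inp = s.inp ∧ s'.out = s.out ∧
      s'.time ≤ s.time + 72 * S.card + 30 ∧ s'.reg 11 = (restr r b S).card ∧
      Level s'.reg r (restr r b S) ∧ Inv n s'.reg ∧ s'.reg 35 = r ∧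
      ∀ a, 32 ≤ a → a ≠ 34 → a ≠ 35 → a ≠ addr 4 r →
        (∀ i, 3 ^ r ≤ i → i < 2 * 3 ^ r → a ≠ addr 2 i ∧ a ≠ addr 3 i) → s'.reg a = s.reg a) s := by
  have hq : 0 < 3 ^ r := by positivity
  have hrq : r < 3 ^ r := r.lt_pow_self (by norm_num)
  have h3 : 3 ^ (r + 1) = 3 * 3 ^ r := pow_succ' 3 r
  have hn : 3 ^ (r + 1) ≤ 3 ^ n := Nat.pow_le_pow_right (by norm_num) hr
  have hn' : 3 ^ (n + 1) = 3 * 3 ^ n := pow_succ' 3 n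
  have hcard := hS.card_le
  simp only [build, wp_seq, wp_const, wp_sub, wp_aload, Function.update_self,
    Function.update_of_ne, ne_eq, not_false_eq_true, Nat.reduceEqDiff, OfNat.ofNat_ne_zero,
    OfNat.ofNat_ne_one, addr_eq_small, Nat.reduceLT, h32, hI.pow (r + 1) hr, hS.count,
    Nat.add_sub_cancel, hI.pow r hr.le]
  refine ⟨by omega, by omega, by omega, by omega, ?_⟩
  set R' := Function.update (Function.update (Function.update (Function.update (Function.update
    (Function.update (Function.update (Function.update (Function.update (Function.update
    (Function.update (Function.update s.reg 0 (addr 0 (r + 1))) 1 64) 8 (3 ^ (r + 1))) 0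
    (addr 4 (r + 1))) 1 68) 9 S.card) 4 1) 35 r) 0 (addr 0 r)) 1 64) 34 (3 ^ r)) 11 0
  have hfr : ∀ a, 32 ≤ a → a ≠ 34 → a ≠ 35 → R' a = s.reg a := by
    intro a ha h1 h2
    have : ∀ x < 32, a ≠ x := fun x hx => by omega
    simp [R', this, h1, h2]
  have hadd : ∀ j i, R' (addr j i) = s.reg (addr j i) := fun j i =>
    hfr _ (by unfold addr; omega) (by unfold addr; omega) (by unfold addr; omega)
  set cs := (List.range S.card).map fun t => s.reg (addr 2 (3 ^ (r + 1) + t)) with hcs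
  have hcsS : cs.toFinset = S := hS.lists
  have hlen : cs.length = S.card := by simp [hcs]
  have key := buildLoop_spec (l := l) (q := 3 ^ r) (b := b) hq hl hb cs (a := 3 ^ (r + 1))
    (s := ⟨R', s.inp, s.out, s.time + 5 + 5 + 1 + 1 + 5 + 1⟩) (S := ∅)
    (by simp [R']) ((hfr 33 (by norm_num) (by norm_num) (by norm_num)).trans h33) (by simp [R'])
    (by simp [R']) (by omega) (by omega) (by simp [R', hlen])
    (fun t ht => (hadd _ _).trans (by simp [hcs]))
    (fun c hc => by rw [← h3]; exact hS.lt c (hcsS ▸ List.mem_toFinset.2 hc))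
    (fun i hi => (hadd _ _).trans_le (hI.pos i (by omega)))
    (fun i hi => (hadd _ _).trans_le (hI.list i (by omega)))
    ⟨rfl, by simp, by simp⟩
  refine wp_mono key ?_
  rintro s₁ ⟨ei, eo, et, e11, eB, epos, elist, efr⟩
  rw [hcsS, empty_union] at e11 eB
  change _ = (restr r b S).card at e11
  change Building _ _ (restr r b S) at eB
  have es : ∀ x, 32 ≤ x → x < 64 → s₁.reg x = R' x := fun x h1 h2 =>
    efr x h1 fun i' _ _ => by unfold addr; omega
  have e35 : s₁.reg 35 = r := (es 35 (by norm_num) (by norm_num)).trans (by simp [R'])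
  simp only [wp_astore, ne_eq, OfNat.ofNat_ne_zero, OfNat.ofNat_ne_one, not_false_eq_true, e35,
    Function.update_of_ne, small_eq_addr, Nat.reduceLT, e11]
  have ha : ∀ j i, j < 8 → (j ≠ 4 ∨ i ≠ r) → Function.update (Function.update (Function.update
      s₁.reg 0 (addr 4 r)) 1 68) (addr 4 r) (restr r b S).card (addr j i) = s₁.reg (addr j i) := by
    intro j i hj hji
    have h0 : addr j i ≠ 0 := by unfold addr; omega
    have h1 : addr j i ≠ 1 := by unfold addr; omega
    have h4 : addr j i ≠ addr 4 r := by rw [ne_eq, addr_inj hj (by norm_num)]; omega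
    simp [h0, h1, h4]
  refine ⟨by omega, ei, eo, ?_, trivial, ⟨by simp, ?_, eB.lt⟩, ?_, trivial, ?_⟩
  · rw [hlen] at et
    simp only at et
    omega
  · exact eB.lists.congr fun t _ => ha _ _ (by norm_num) (.inl (by norm_num))
  · have hout : ∀ j i, j ≠ 4 → j < 8 → (2 * 3 ^ r ≤ i ∨ j < 2) →
        s₁.reg (addr j i) = s.reg (addr j i) := fun j i hj hj8 hi =>
      (efr _ (by unfold addr; omega) fun i' h1 h2 => by
        rw [ne_eq, ne_eq, addr_inj hj8 (by norm_num), addr_inj hj8 (by norm_num)]; omega).trans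
        (hadd _ _)
    have h36 : s₁.reg 36 = s.reg 36 := (es 36 (by norm_num) (by norm_num)).trans
      (hfr 36 (by norm_num) (by norm_num) (by norm_num))
    have h37 : s₁.reg 37 = s.reg 37 := (es 37 (by norm_num) (by norm_num)).trans
      (hfr 37 (by norm_num) (by norm_num) (by norm_num))
    have hI₁ : Inv n s₁.reg := by
      refine ⟨fun i hi => ?_, fun i hi => ?_, fun i hi => ?_, fun i hi => ?_, h36.trans hI.first, ?_⟩
      · rw [hout _ _ (by norm_num) (by norm_num) (.inr (by norm_num))]; exact hI.pow i hi
      · rw [hout _ _ (by norm_num) (by norm_num) (.inr (by norm_num))]; exact hI.cell i hi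
      · by_cases h : i < 3 * 3 ^ r
        · exact elist i h
        · rw [hout _ _ (by norm_num) (by norm_num) (.inl (by omega))]; exact hI.list i hi
      · by_cases h : i < 3 * 3 ^ r
        · exact epos i h
        · rw [hout _ _ (by norm_num) (by norm_num) (.inl (by omega))]; exact hI.pos i hi
      · rw [h37]; exact hI.last
    refine hI₁.congr ?_ ?_ fun j hj i _ => ha j i (by omega) (.inl (by omega))
    · simp [small_eq_addr]
    · simp [small_eq_addr]
  · intro a ha h1 h2 h4 h5
    have h6 : a ≠ 0 := by omega
    have h7 : a ≠ 1 := by omega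
    simp only [Function.update_of_ne, ne_eq, h4, h6, h7, not_false_eq_true]
    exact (efr a ha h5).trans (hfr a ha h1 h2)

/-! ### The search -/

/-- One step of the search. `R 32` is the level of the current node and `R 38` is one more than
the number of its children that have not been tried. -/
def searchStep : Cmd :=
  .ite 32
    (.prim (.const 4 1) ;; .prim (.sub 6 38 4) ;;
      .ite 6
        (astore 5 32 6 ;; .prim (.const 4 2) ;; .prim (.sub 33 4 6) ;; build ;;
          .ite 11
            (aload 19 1 35 ;; .prim (.store 19 33) ;; .prim (.copy 32 35) ;; .prim (.const 4 3) ;;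
              astore 5 32 4)
            .skip)
        (.prim (.const 4 1) ;; .prim (.add 32 32 4)))
    (.prim (.output 36 37) ;; .prim (.const 32 1)) ;;
  aload 38 5 32

/-- The recursion is flattened into one loop: array 5 keeps, for each level, one more than the
number of untried children. The entry 0 at level `n + 1` stops the loop. -/
def search : Cmd := .loop 38 searchStep

/-- The search gets from state `s` to state `s'`. -/
def Leads (s s' : St) : Prop := ∀ s'', Exec realCost search s' s'' → Exec realCost search s s''

theorem Leads.trans {s₁ s₂ s₃ : St} (h : Leads s₁ s₂) (h' : Leads s₂ s₃) : Leads s₁ s₃ :=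
  fun s hs => h s (h' s hs)

/-- The digit bound `l` is chosen anew for every iteration, which allows deep nodes to be cheap. The
extra 2 pays for the loop test and the jump back. -/
theorem leads_of_wp {l K : ℕ} {s : St} {P : (ℕ → ℕ) → List ℕ → List (List ℕ) → Prop}
    (h38 : s.reg 38 ≠ 0)
    (h : wp l searchStep (fun s' => P s'.reg s'.inp s'.out ∧ s'.time ≤ s.time + K) s) :
    ∃ s', Leads s s' ∧ P s'.reg s'.inp s'.out ∧ s'.time ≤ s.time + (2 * l + 1) * K + 2 := by
  obtain ⟨s₁, hex, hP, ht⟩ := h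
  obtain ⟨t', h1, h2⟩ := hex.real.2 (s.time + 1)
  refine ⟨s₁.withTime (t' + 1), fun s'' h => .loopStep h38 h2 h, hP, ?_⟩
  have : (2 * l + 1) * s₁.time ≤ (2 * l + 1) * (s.time + K) := Nat.mul_le_mul_left _ ht
  rw [Nat.mul_add] at this
  simp only [St.withTime]
  omega

/-- What is left alone while the subtree of a node of level `r` is searched. -/
structure SearchFrame (n r : ℕ) (R R' : ℕ → ℕ) : Prop where
  count : ∀ i, r < i → i ≤ n + 1 → R' (addr 4 i) = R (addr 4 i)
  tries : ∀ i, r < i → i ≤ n + 1 → R' (addr 5 i) = R (addr 5 i)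
  list : ∀ i, 3 ^ (r + 1) ≤ i → i < 3 ^ (n + 1) → R' (addr 2 i) = R (addr 2 i)
  cell : ∀ i, r ≤ i → R' (base n + i) = R (base n + i)

theorem SearchFrame.trans {n r : ℕ} {R₁ R₂ R₃ : ℕ → ℕ} (h : SearchFrame n r R₁ R₂)
    (h' : SearchFrame n r R₂ R₃) : SearchFrame n r R₁ R₃ :=
  ⟨fun i h1 h2 => (h'.count i h1 h2).trans (h.count i h1 h2),
    fun i h1 h2 => (h'.tries i h1 h2).trans (h.tries i h1 h2),
    fun i h1 h2 => (h'.list i h1 h2).trans (h.list i h1 h2),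
    fun i h1 => (h'.cell i h1).trans (h.cell i h1)⟩

theorem SearchFrame.succ {n r : ℕ} {R R' : ℕ → ℕ} (h : SearchFrame n r R R') :
    SearchFrame n (r + 1) R R' :=
  ⟨fun i h1 h2 => h.count i (by omega) h2, fun i h1 h2 => h.tries i (by omega) h2,
    fun i h1 h2 => h.list i (le_trans (Nat.pow_le_pow_right (by norm_num) (by omega)) h1) h2,
    fun i h1 => h.cell i (by omega)⟩

theorem Level.congr {R R' : ℕ → ℕ} {r : ℕ} {S : Finset ℕ} (h : Level R r S)
    (h4 : R' (addr 4 r) = R (addr 4 r))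
    (h2 : ∀ i, 3 ^ r ≤ i → i < 2 * 3 ^ r → R' (addr 2 i) = R (addr 2 i)) : Level R' r S := by
  have := h.card_le
  exact ⟨h4.trans h.count, h.lists.congr fun t ht => h2 _ (by omega) (by omega), h.lt⟩

/-- The search below level `r + 1` changes array 2 only below `3 ^ (r + 1)`, where the parent's list
begins. -/
theorem Level.of_frame {n r : ℕ} {R R' : ℕ → ℕ} {S : Finset ℕ} (h : Level R (r + 1) S)
    (hr : r < n) (hf : SearchFrame n r R R') : Level R' (r + 1) S := by
  have hn : 3 ^ (r + 1) ≤ 3 ^ n := Nat.pow_le_pow_right (by norm_num) hr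
  have hn' : 3 ^ (n + 1) = 3 * 3 ^ n := pow_succ' 3 n
  have hpos : 0 < 3 ^ n := by positivity
  exact h.congr (hf.count _ (by omega) (by omega)) fun i h1 h2 => hf.list i h1 (by omega)

theorem addr_lt_base {n j i : ℕ} (hj : j < 8) (hi : i < 3 ^ (n + 1)) : addr j i < base n := by
  unfold addr base; omega

/-- The state after a child has been tried. -/
structure Tried (n r b d : ℕ) (S : Finset ℕ) (R R' : ℕ → ℕ) : Prop where
  inv : Inv n R'
  level : Level R' (r + 1) S
  frame : SearchFrame n (r + 1) R R'
  tries : R' (addr 5 (r + 1)) = d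
  down : (restr r b S).Nonempty → R' 32 = r ∧ R' 38 = 3 ∧ R' (addr 5 r) = 3 ∧
    Level R' r (restr r b S) ∧ R' (base n + r) = b
  stay : ¬ (restr r b S).Nonempty → R' 32 = r + 1 ∧ R' 38 = d

/-- The step records that `d - 1` children remain and tries the bit `b = 2 - d`. The address of the
output cell is loaded from array 1 and only used in an indirect store, so its size, which grows with
`n`, costs nothing. -/
theorem searchStep_child {l n r b d : ℕ} {s : St} {S : Finset ℕ} (hl : 400 * 3 ^ r ≤ 2 ^ l)
    (hr : r < n) (hbd : b + d = 2) (hd : 1 ≤ d) (h32 : s.reg 32 = r + 1) (h38 : s.reg 38 = d + 1)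
    (hI : Inv n s.reg) (hS : Level s.reg (r + 1) S) :
    wp l searchStep (fun s' => (Tried n r b d S s.reg s'.reg ∧ s'.inp = s.inp ∧ s'.out = s.out) ∧
      s'.time ≤ s.time + (72 * S.card + 70)) s := by
  have hq : 0 < 3 ^ r := by positivity
  have hrq : r < 3 ^ r := r.lt_pow_self (by norm_num)
  have h3 : 3 ^ (r + 1) = 3 * 3 ^ r := pow_succ' 3 r
  have hn : 3 ^ (r + 1) ≤ 3 ^ n := Nat.pow_le_pow_right (by norm_num) hr
  have hn' : 3 ^ (n + 1) = 3 * 3 ^ n := pow_succ' 3 n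
  have hnn : n < 3 ^ n := n.lt_pow_self (by norm_num)
  have hb : b ≤ 1 := by omega
  have hd2 : d ≤ 2 := by omega
  have e1 : 2 - d = b := by omega
  simp only [searchStep, wp_seq, wp_ite, wp_const, wp_sub, wp_astore, Function.update_self,
    Function.update_of_ne, ne_eq, not_false_eq_true, Nat.reduceEqDiff, OfNat.ofNat_ne_zero,
    OfNat.ofNat_ne_one, small_eq_addr, Nat.reduceLT, St.tick, h32, h38, Nat.add_sub_cancel, e1]
  refine ⟨fun _ => ⟨⟨by omega, by omega⟩, fun _ => ⟨by omega, by omega, ?_⟩, fun h => by omega⟩,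
    fun h => absurd h (by simp)⟩
  set R₁ := Function.update (Function.update (Function.update (Function.update (Function.update
    (Function.update (Function.update s.reg 4 1) 6 d) 0 (addr 5 (r + 1))) 1 (64 + 5))
    (addr 5 (r + 1)) d) 4 2) 33 b with hR₁
  have f1 : ∀ a, 32 ≤ a → a ≠ 33 → a ≠ addr 5 (r + 1) → R₁ a = s.reg a := by
    intro a ha h1 h2
    have : ∀ x < 32, a ≠ x := fun x hx => by omega
    simp [R₁, this, h1, h2]
  have f1a : ∀ j < 8, ∀ i, (j ≠ 5 ∨ i ≠ r + 1) → R₁ (addr j i) = s.reg (addr j i) :=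
    fun j hj i hji => f1 _ (by unfold addr; omega) (by unfold addr; omega)
      (by rw [ne_eq, addr_inj hj (by norm_num)]; omega)
  have f1s : ∀ x, 32 ≤ x → x < 64 → x ≠ 33 → R₁ x = s.reg x := fun x h1 h2 h3 =>
    f1 x h1 h3 (by unfold addr; omega)
  have t1 : R₁ (addr 5 (r + 1)) = d := by simp [R₁, addr_eq_small]
  have f1c : ∀ i, R₁ (base n + i) = s.reg (base n + i) := fun i =>
    f1 _ (by unfold base; omega) (by unfold base; omega)
      (by have := addr_lt_base (n := n) (j := 5) (i := r + 1) (by norm_num) (by omega); omega)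
  have hI₁ : Inv n R₁ := hI.congr (f1s 36 (by norm_num) (by norm_num) (by norm_num))
    (f1s 37 (by norm_num) (by norm_num) (by norm_num)) fun j hj i _ => f1a j (by omega) i (by omega)
  have hS₁ : Level R₁ (r + 1) S := hS.congr (f1a 4 (by norm_num) _ (by norm_num))
    fun i _ _ => f1a 2 (by norm_num) _ (by norm_num)
  refine wp_mono (build_spec (r := r) (b := b) hl hr hb
    ((f1s 32 (by norm_num) (by norm_num) (by norm_num)).trans h32) (by simp [R₁]) hI₁ hS₁) ?_
  rintro s₂ ⟨ei, eo, et, e11, eL, eI, e35, efr⟩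
  have f2a : ∀ j < 8, ∀ i, (j = 2 → 2 * 3 ^ r ≤ i) → (j = 3 → 2 * 3 ^ r ≤ i) → (j = 4 → i ≠ r) →
      s₂.reg (addr j i) = R₁ (addr j i) := fun j hj i h1 h2 h3 =>
    efr _ (by unfold addr; omega) (by unfold addr; omega) (by unfold addr; omega)
      (by rw [ne_eq, addr_inj hj (by norm_num)]; omega) fun i' h4 h5 => by
        rw [ne_eq, ne_eq, addr_inj hj (by norm_num), addr_inj hj (by norm_num)]; omega
  have f2s : ∀ x, 32 ≤ x → x < 34 → s₂.reg x = R₁ x := fun x h1 h2 =>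
    efr x h1 (by omega) (by omega) (by unfold addr; omega) fun i _ _ => by unfold addr; omega
  have f2c : ∀ i, s₂.reg (base n + i) = R₁ (base n + i) := fun i =>
    efr _ (by unfold base; omega) (by unfold base; omega) (by unfold base; omega)
      (by have := addr_lt_base (n := n) (j := 4) (i := r) (by norm_num) (by omega); omega)
      fun i' h4 h5 => by
        have := addr_lt_base (n := n) (j := 2) (i := i') (by norm_num) (by omega)
        have := addr_lt_base (n := n) (j := 3) (i := i') (by norm_num) (by omega)
        omega
  have g32 : s₂.reg 32 = r + 1 := (f2s 32 (by norm_num) (by norm_num)).trans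
    ((f1s 32 (by norm_num) (by norm_num) (by norm_num)).trans h32)
  have g33 : s₂.reg 33 = b := (f2s 33 (by norm_num) (by norm_num)).trans (by simp [R₁])
  have t2 : s₂.reg (addr 5 (r + 1)) = d := (f2a 5 (by norm_num) _ (by norm_num) (by norm_num)
    (by norm_num)).trans t1
  have g1 : s₂.reg (addr 1 r) = base n + r := eI.cell r hr
  have hS₂ : Level s₂.reg (r + 1) S := hS₁.congr (f2a 4 (by norm_num) _ (by norm_num) (by norm_num)
    (by omega)) fun i h1 _ => f2a 2 (by norm_num) i (by omega) (by omega) (by omega)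
  have F₂ : SearchFrame n (r + 1) s.reg s₂.reg := by
    refine ⟨fun i h1 h2 => ?_, fun i h1 h2 => ?_, fun i h1 h2 => ?_, fun i h1 => ?_⟩
    · exact (f2a 4 (by norm_num) i (by omega) (by omega) (by omega)).trans
        (f1a 4 (by norm_num) i (by omega))
    · exact (f2a 5 (by norm_num) i (by omega) (by omega) (by omega)).trans
        (f1a 5 (by norm_num) i (by omega))
    · have : 3 ^ (r + 1 + 1) = 3 * 3 ^ (r + 1) := pow_succ' 3 (r + 1)
      exact (f2a 2 (by norm_num) i (by omega) (by omega) (by omega)).trans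
        (f1a 2 (by norm_num) i (by omega))
    · exact (f2c i).trans (f1c i)
  simp only at et
  simp only [wp_seq, wp_ite, wp_const, wp_aload, wp_astore, wp_store, wp_copy, wp_skip,
    Function.update_self, Function.update_of_ne, ne_eq, not_false_eq_true, Nat.reduceEqDiff,
    OfNat.ofNat_ne_zero, OfNat.ofNat_ne_one, small_eq_addr, Nat.reduceLT, St.tick, g32,
    g33, e11, e35, g1, t2]
  refine ⟨fun hc => ?_, fun hc => ?_⟩
  · have hbase : ∀ x < 64, ¬ x = base n + r := fun x hx => by unfold base; omega
    simp only [hbase, Nat.reduceLT, Function.update_of_ne, ne_eq,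
      not_false_eq_true, Nat.reduceEqDiff, OfNat.ofNat_ne_zero, OfNat.ofNat_ne_one, e35]
    refine ⟨by omega, by omega, by omega, ⟨?_, ei, eo⟩, by omega⟩
    generalize hR : Function.update (β := fun _ => ℕ) _ 38 3 = R₃
    have hbr : base n + r ≠ 38 := by unfold base; omega
    have f3 : ∀ a, 32 ≤ a → a ≠ 32 → a ≠ 38 → a ≠ base n + r → a ≠ addr 5 r →
        R₃ a = s₂.reg a := by
      intro a ha h1 h2 h3 h4
      have : ∀ x < 32, a ≠ x := fun x hx => by omega
      simp [← hR, this, h1, h2, h3, h4]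
    have f3a : ∀ j < 8, ∀ i < 3 ^ (n + 1), (j ≠ 5 ∨ i ≠ r) → R₃ (addr j i) = s₂.reg (addr j i) :=
      fun j hj i hi hji => f3 _ (by unfold addr; omega) (by unfold addr; omega)
        (by unfold addr; omega) (by have := addr_lt_base (n := n) hj hi; omega)
        (by rw [ne_eq, addr_inj hj (by norm_num)]; omega)
    have F₃ : SearchFrame n (r + 1) s₂.reg R₃ := by
      refine ⟨fun i h1 h2 => ?_, fun i h1 h2 => ?_, fun i h1 h2 => ?_, fun i h1 => ?_⟩
      · exact f3a 4 (by norm_num) i (by omega) (by omega)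
      · exact f3a 5 (by norm_num) i (by omega) (by omega)
      · exact f3a 2 (by norm_num) i (by omega) (by omega)
      · exact f3 _ (by unfold base; omega) (by unfold base; omega) (by unfold base; omega)
          (by omega) (by have := addr_lt_base (n := n) (j := 5) (i := r) (by norm_num) (by omega)
                         omega)
    refine ⟨?_, ?_, F₂.trans F₃, ?_, fun _ => ⟨?_, ?_, ?_, ?_, ?_⟩,
      fun h => absurd (card_pos.1 (Nat.pos_of_ne_zero hc)) h⟩
    · exact eI.congr (f3 36 (by norm_num) (by norm_num) (by norm_num)
        (by unfold base; omega) (by unfold addr; omega))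
        (f3 37 (by norm_num) (by norm_num) (by norm_num)
        (by unfold base; omega) (by unfold addr; omega))
        fun j hj i hi => f3a j (by omega) i hi (by omega)
    · exact hS₂.congr (f3a 4 (by norm_num) _ (by omega) (by norm_num))
        fun i h1 h2 => f3a 2 (by norm_num) i (by omega) (by norm_num)
    · exact (f3a 5 (by norm_num) _ (by omega) (by omega)).trans t2
    · simp [← hR, small_eq_addr]
    · simp [← hR]
    · simp [← hR, addr_eq_small]
    · exact eL.congr (f3a 4 (by norm_num) _ (by omega) (by norm_num))
        fun i h1 h2 => f3a 2 (by norm_num) i (by omega) (by norm_num)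
    · have h1 : base n + r ≠ addr 5 r := by
        have := addr_lt_base (n := n) (j := 5) (i := r) (by norm_num) (by omega)
        omega
      have h2 : ∀ x < 64, base n + r ≠ x := fun x hx => by unfold base; omega
      have h0 : base n ≠ 0 := by unfold base; omega
      simp [← hR, h1, h2, h0]
  · refine ⟨by omega, ⟨?_, ei, eo⟩, by omega⟩
    generalize hR : Function.update (β := fun _ => ℕ) _ 38 d = R₃
    have f3 : ∀ a, 32 ≤ a → a ≠ 38 → R₃ a = s₂.reg a := by
      intro a ha h1
      have : ∀ x < 32, a ≠ x := fun x hx => by omega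
      simp [← hR, this, h1]
    have f3a : ∀ j i, R₃ (addr j i) = s₂.reg (addr j i) :=
      fun j i => f3 _ (by unfold addr; omega) (by unfold addr; omega)
    have F₃ : SearchFrame n (r + 1) s₂.reg R₃ :=
      ⟨fun i _ _ => f3a 4 i, fun i _ _ => f3a 5 i, fun i _ _ => f3a 2 i,
        fun i _ => f3 _ (by unfold base; omega) (by unfold base; omega)⟩
    refine ⟨?_, ?_, F₂.trans F₃, (f3a 5 _).trans t2,
      fun h => absurd hc (card_pos.2 h).ne', fun _ => ⟨?_, ?_⟩⟩
    · exact eI.congr (f3 36 (by norm_num) (by norm_num)) (f3 37 (by norm_num) (by norm_num))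
        fun j _ i _ => f3a j i
    · exact hS₂.congr (f3a 4 _) fun i _ _ => f3a 2 i
    · exact (f3 32 (by norm_num) (by norm_num)).trans g32
    · simp [← hR]

/-- After a subtree of level `r` has been searched, the search goes on at level `r + 1`. -/
structure Returned (n r : ℕ) (R R' : ℕ → ℕ) : Prop where
  inv : Inv n R'
  level : R' 32 = r + 1
  tries : R' 38 = R' (addr 5 (r + 1))
  frame : SearchFrame n r R R'

theorem searchStep_up {l n r : ℕ} {s : St} (hl : 400 * 3 ^ r ≤ 2 ^ l)
    (h32 : s.reg 32 = r + 1) (h38 : s.reg 38 = 1) (hI : Inv n s.reg) :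
    wp l searchStep (fun s' => (Returned n (r + 1) s.reg s'.reg ∧ s'.inp = s.inp ∧ s'.out = s.out) ∧
      s'.time ≤ s.time + 20) s := by
  have hrq : r < 3 ^ r := r.lt_pow_self (by norm_num)
  simp only [searchStep, wp_seq, wp_ite, wp_const, wp_sub, wp_add, wp_aload, Function.update_self,
    Function.update_of_ne, ne_eq, not_false_eq_true, Nat.reduceEqDiff, OfNat.ofNat_ne_zero,
    St.tick, h32, h38, Nat.sub_self, addr_eq_small, Nat.reduceLT]
  refine ⟨fun _ => ⟨⟨by omega, by omega⟩, fun h => absurd trivial h,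
    fun _ => ⟨by omega, by omega, ⟨?_, trivial, trivial⟩, by omega⟩⟩, fun h => absurd h (by simp)⟩
  generalize hR : Function.update _ 38 _ = R'
  have f : ∀ a, 33 ≤ a → a ≠ 38 → R' a = s.reg a := by
    intro a ha h1
    have : ∀ x < 33, a ≠ x := fun x hx => by omega
    simp [← hR, this, h1]
  have fa : ∀ j i, R' (addr j i) = s.reg (addr j i) :=
    fun j i => f _ (by unfold addr; omega) (by unfold addr; omega)
  refine ⟨hI.congr (f 36 (by norm_num) (by norm_num)) (f 37 (by norm_num) (by norm_num))
      fun j _ i _ => fa j i, by simp [← hR], by rw [fa]; simp [← hR],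
    ⟨fun i _ _ => fa 4 i, fun i _ _ => fa 5 i, fun i _ _ => fa 2 i,
        fun i _ => f _ (by unfold base; omega) (by unfold base; omega)⟩⟩

/-- Seven digits suffice because the bounds of the output block are kept in `R 36` and `R 37` and
are not computed. For `n = 0` the block ends before it begins and the empty word is output. -/
theorem searchStep_output {n : ℕ} {s : St} (h32 : s.reg 32 = 0) (hI : Inv n s.reg) :
    wp 7 searchStep (fun s' => (Returned n 0 s.reg s'.reg ∧ s'.inp = s.inp ∧
      s'.out = s.out ++ [(List.range' (base n) n).map s.reg]) ∧ s'.time ≤ s.time + 20) s := by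
  simp only [searchStep, wp_seq, wp_ite, wp_const, wp_output, wp_aload, Function.update_self,
    Function.update_of_ne, ne_eq, not_false_eq_true, OfNat.ofNat_ne_zero,
    St.tick, h32, addr_eq_small, Nat.reduceLT, hI.first, hI.last,
    Nat.add_sub_cancel_left]
  refine ⟨fun h => absurd trivial h, fun _ => ⟨by norm_num, ⟨?_, trivial, trivial⟩, by omega⟩⟩
  generalize hR : Function.update _ 38 _ = R'
  have f : ∀ a, 33 ≤ a → a ≠ 38 → R' a = s.reg a := by
    intro a ha h1
    have : ∀ x < 33, a ≠ x := fun x hx => by omega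
    simp [← hR, this, h1]
  have fa : ∀ j i, R' (addr j i) = s.reg (addr j i) :=
    fun j i => f _ (by unfold addr; omega) (by unfold addr; omega)
  refine ⟨hI.congr (f 36 (by norm_num) (by norm_num)) (f 37 (by norm_num) (by norm_num))
      fun j _ i _ => fa j i, by simp [← hR], by rw [fa]; simp [← hR],
    ⟨fun i _ _ => fa 4 i, fun i _ _ => fa 5 i, fun i _ _ => fa 2 i,
        fun i _ => f _ (by unfold base; omega) (by unfold base; omega)⟩⟩

/-- Operands at level `r` are below `400 * 3 ^ r`, hence of `O(r)` binary digits; `400 ≤ 2 ^ 9` and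
`3 ≤ 2 ^ 2`. -/
theorem capacity (r : ℕ) : 400 * 3 ^ r ≤ 2 ^ (2 * r + 9) := by
  have : 3 ^ r ≤ 4 ^ r := Nat.pow_le_pow_left (by norm_num) r
  rw [pow_add, pow_mul]
  norm_num
  omega

/-- Values of the variables `r, r + 1, …` -/
def suffix (n r : ℕ) (R : ℕ → ℕ) : List ℕ := (List.range' (base n + r) (n - r)).map R

theorem suffix_congr {n r : ℕ} {R R' : ℕ → ℕ} (h : ∀ i, r ≤ i → R' (base n + i) = R (base n + i)) :
    suffix n r R' = suffix n r R := by
  refine List.map_congr_left fun a ha => ?_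
  rw [List.mem_range'_1] at ha
  obtain ⟨i, rfl⟩ := Nat.exists_eq_add_of_le (le_trans (Nat.le_add_right _ _) ha.1)
  exact h i (by omega)

theorem suffix_eq_cons {n r : ℕ} (hr : r < n) (R : ℕ → ℕ) :
    suffix n r R = R (base n + r) :: suffix n (r + 1) R := by
  rw [suffix, suffix, show n - r = n - (r + 1) + 1 by omega, List.range'_succ]
  rfl

/-- The subtree of a node is searched within the time bound `searchCost`. -/
theorem search_spec {n r : ℕ} {S : Finset ℕ} {s : St} (hr : r ≤ n) (hI : Inv n s.reg)
    (hS : Level s.reg r S) (h32 : s.reg 32 = r) (h38 : s.reg 38 = 3)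
    (h5 : s.reg (addr 5 r) = 3) :
    ∃ s', Leads s s' ∧ Returned n r s.reg s'.reg ∧ s'.inp = s.inp ∧
      s'.out = s.out ++ models r S (suffix n r s.reg) ∧
      s'.time ≤ s.time + 2000 * searchCost r S := by
  induction r generalizing S s with
  | zero =>
    obtain ⟨s', h1, ⟨h2, h3, h4⟩, h5⟩ := leads_of_wp
      (P := fun R i o => Returned n 0 s.reg R ∧ i = s.inp ∧
        o = s.out ++ [(List.range' (base n) n).map s.reg]) (by omega) (searchStep_output h32 hI)
    refine ⟨s', h1, h2, h3, h4, ?_⟩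
    -- `302 = (2 * 7 + 1) * 20 + 2`.
    have h6 : s'.time ≤ s.time + 302 := by simpa using h5
    have h7 : searchCost 0 S = 4 * (S.card + 1) := rfl
    rw [h7]
    linarith [Nat.zero_le S.card]
  | succ r ih =>
    -- One child with its whole subtree; it is applied to the bits 0 and 1 in turn and followed by a
    -- step upwards.
    have child : ∀ (b d : ℕ) (s : St), b + d = 2 → 1 ≤ d → Inv n s.reg → Level s.reg (r + 1) S →
        s.reg 32 = r + 1 → s.reg 38 = d + 1 → ∃ s', Leads s s' ∧ Inv n s'.reg ∧
          Level s'.reg (r + 1) S ∧ s'.reg 32 = r + 1 ∧ s'.reg 38 = d ∧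
          SearchFrame n (r + 1) s.reg s'.reg ∧ s'.inp = s.inp ∧
          s'.out = s.out ++ (if (restr r b S).Nonempty then
            models r (restr r b S) (b :: suffix n (r + 1) s.reg) else []) ∧
          s'.time ≤ s.time + (4 * r + 19) * (72 * S.card + 70) + 2 +
            2000 * (if (restr r b S).Nonempty then searchCost r (restr r b S) else 0) := by
      intro b d s hbd hd hI hS h32 h38
      obtain ⟨s₁, h1, ⟨h2, h3, h4⟩, h5⟩ := leads_of_wp
        (P := fun R i o => Tried n r b d S s.reg R ∧ i = s.inp ∧ o = s.out) (by omega)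
        (searchStep_child (capacity r) hr hbd hd h32 h38 hI hS)
      rw [show 2 * (2 * r + 9) + 1 = 4 * r + 19 by ring] at h5
      by_cases hne : (restr r b S).Nonempty
      · obtain ⟨g1, g2, g3, g4, g5⟩ := h2.down hne
        obtain ⟨s₂, k1, k2, k3, k4, k5⟩ := ih (by omega) h2.inv g4 g1 g2 g3
        refine ⟨s₂, h1.trans k1, k2.inv, h2.level.of_frame hr k2.frame, k2.level, ?_,
          h2.frame.trans k2.frame.succ, k3.trans h3, ?_, ?_⟩
        · rw [k2.tries, k2.frame.tries _ (by omega) (by omega), h2.tries]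
        -- Cell `r` now holds `b` and the later cells are unchanged, so the suffix of the child is
        -- `b` followed by that of the parent.
        · rw [k4, h4, if_pos hne, suffix_eq_cons hr, g5, suffix_congr h2.frame.cell]
        · rw [if_pos hne]; omega
      · obtain ⟨g1, g2⟩ := h2.stay hne
        refine ⟨s₁, h1, h2.inv, h2.level, g1, g2, h2.frame, h3, ?_, ?_⟩
        · rw [h4, if_neg hne, List.append_nil]
        · rw [if_neg hne]; omega
    obtain ⟨s₁, a1, a2, a3, a4, a5, a6, a7, a8, a9⟩ :=
      child 0 2 s rfl (by norm_num) hI hS h32 h38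
    obtain ⟨s₂, b1, b2, b3, b4, b5, b6, b7, b8, b9⟩ :=
      child 1 1 s₁ rfl (by norm_num) a2 a3 a4 a5
    obtain ⟨s₃, c1, ⟨c2, c3, c4⟩, c5⟩ := leads_of_wp
      (P := fun R i o => Returned n (r + 1) s₂.reg R ∧ i = s₂.inp ∧ o = s₂.out) (by omega)
      (searchStep_up (capacity r) b4 b5 b2)
    refine ⟨s₃, (a1.trans b1).trans c1,
      ⟨c2.inv, c2.level, c2.tries, (a6.trans b6).trans c2.frame⟩, c3.trans (b7.trans a7), ?_, ?_⟩
    · rw [c4, b8, a8, suffix_congr a6.cell, models, List.append_assoc]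
    · rw [searchCost]
      generalize (if (restr r 0 S).Nonempty then searchCost r (restr r 0 S) else 0) = x at *
      generalize (if (restr r 1 S).Nonempty then searchCost r (restr r 1 S) else 0) = y at *
      have e1 : 4 * r + 19 ≤ 7 * (r + 3) ^ 2 := by nlinarith
      have e2 : (4 * r + 19) * (72 * S.card + 70) ≤ 7 * (r + 3) ^ 2 * (72 * (S.card + 1)) :=
        Nat.mul_le_mul e1 (by omega)
      have e3 : (r + 3) ^ 2 * 1 ≤ (r + 3) ^ 2 * (S.card + 1) := Nat.mul_le_mul_left _ (by omega)
      have e4 : 7 * (r + 3) ^ 2 * (72 * (S.card + 1)) = 504 * ((r + 3) ^ 2 * (S.card + 1)) := by ring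
      have e5 : 9 ≤ (r + 3) ^ 2 := by nlinarith
      omega

end DNFEnum
namespace DNFEnum
open RAM Finset

/-! ### Reading of the input -/

/-- Read a number in binary to `R 3`; the letter that follows it goes to `R 2`. -/
def readNum : Cmd :=
  .prim (.const 3 0) ;; .prim (.read 2) ;; .prim (.const 4 3) ;; .prim (.sub 5 4 2) ;;
  .prim (.mul 5 5 2) ;;
  .loop 5 (.prim (.add 3 3 3) ;; .prim (.add 3 3 2) ;; .prim (.const 4 1) ;; .prim (.sub 3 3 4) ;;
    .prim (.read 2) ;; .prim (.const 4 3) ;; .prim (.sub 5 4 2) ;; .prim (.mul 5 5 2))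

/-- The value of a binary number with most significant digit first, preceded by `v`. -/
def binValue (v : ℕ) (d : List Bool) : ℕ := d.foldl (fun v b => 2 * v + b.toNat) v

theorem le_binValue (v : ℕ) (d : List Bool) : v ≤ binValue v d := by
  induction d generalizing v with
  | nil => exact le_rfl
  | cons b d ih =>
    have := ih (2 * v + b.toNat)
    simp only [binValue, List.foldl_cons] at *
    omega

theorem binValue_bits (m : ℕ) : binValue 0 (Nat.bits m).reverse = m := by
  rw [binValue, List.foldl_reverse]
  induction m using Nat.binaryRec' with
  | zero => simp
  | bit b n h ih =>
    rw [Nat.bits_append_bit n b h, List.foldr_cons, ih]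
    cases b <;> simp [Nat.bit]

/-- The digits of a number as they are read. -/
def digitCodes (d : List Bool) : List ℕ := d.map fun b => b.toNat + 1

/-- The product `(3 - R 2) * R 2` is nonzero exactly for the codes 1 and 2 of the digits:
subtraction is truncated, and 0 marks the end of the input. The digit is the letter code minus one.
-/
theorem readNum_loop {l : ℕ} (d : List Bool) {v : ℕ} {rest : List ℕ} {s : St}
    (hl : 4 * binValue v d + 30 < 2 ^ l) (hr : rest.headD 0 = 0 ∨ 3 ≤ rest.headD 0)
    (hr' : rest.headD 0 ≤ 5) (h3 : s.reg 3 = v)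
    (h2 : s.reg 2 = (digitCodes d ++ rest).headD 0) (hin : s.inp = (digitCodes d ++ rest).tail)
    (h5 : s.reg 5 = (3 - s.reg 2) * s.reg 2) :
    wp l (.loop 5 (.prim (.add 3 3 3) ;; .prim (.add 3 3 2) ;; .prim (.const 4 1) ;;
      .prim (.sub 3 3 4) ;; .prim (.read 2) ;; .prim (.const 4 3) ;; .prim (.sub 5 4 2) ;;
      .prim (.mul 5 5 2))) (fun s' => s'.reg 3 = binValue v d ∧ s'.reg 2 = rest.headD 0 ∧
        s'.inp = rest.tail ∧ s'.out = s.out ∧ s'.time ≤ s.time + 10 * d.length + 1 ∧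
        ∀ a, 6 ≤ a → s'.reg a = s.reg a) s := by
  induction d generalizing v s with
  | nil =>
    simp only [digitCodes, List.map_nil, List.nil_append] at h2 hin
    refine wp_loop_done ?_ ⟨h3, h2, hin, rfl, by simp [St.tick], fun _ _ => rfl⟩
    rw [h5, h2]
    rcases hr with h | h
    · rw [h]
    · rw [Nat.sub_eq_zero_of_le h, zero_mul]
  | cons b d ih =>
    simp only [digitCodes, List.map_cons, List.cons_append, List.headD_cons, List.tail_cons]
      at h2 hin
    change s.inp = digitCodes d ++ rest at hin
    have hb : b.toNat ≤ 1 := b.toNat_le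
    have hbin : binValue v (b :: d) = binValue (2 * v + b.toNat) d := rfl
    have hle := le_binValue (2 * v + b.toNat) d
    rw [hbin] at hl
    have hch : (digitCodes d ++ rest).headD 0 ≤ 5 := by
      cases d with
      | nil => exact hr'
      | cons b' d =>
        simp only [digitCodes, List.map_cons, List.cons_append, List.headD_cons]
        have : b'.toNat ≤ 1 := b'.toNat_le
        omega
    have h5' : s.reg 5 ≠ 0 := by
      rw [h5, h2]
      cases b <;> simp
    refine wp_loop_step h5' ?_
    simp only [wp_seq, wp_add, wp_const, wp_sub, wp_mul, wp_read, Function.update_self,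
      Function.update_of_ne, ne_eq, not_false_eq_true, Nat.reduceEqDiff, St.tick, h3, h2, hin]
    refine ⟨by omega, by omega, by omega, by omega, by omega, ?_⟩
    refine wp_mono (ih (v := 2 * v + b.toNat) hl ?_ ?_ rfl ?_) ?_
    · simp; omega
    · simp
    · simp
    · rintro s' ⟨e3, e2, ei, eo, et, ef⟩
      refine ⟨e3, e2, ei, eo, ?_, fun a ha => (ef a ha).trans ?_⟩
      · simp only [List.length_cons] at et ⊢; omega
      · have : ∀ x < 6, a ≠ x := fun x hx => by omega
        simp [this]

theorem readNum_spec {l m : ℕ} {rest : List ℕ} {s : St} (hl : 4 * m + 30 < 2 ^ l)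
    (hr : rest.headD 0 = 0 ∨ 3 ≤ rest.headD 0) (hr' : rest.headD 0 ≤ 5)
    (hin : s.inp = digitCodes (Nat.bits m).reverse ++ rest) :
    wp l readNum (fun s' => s'.reg 3 = m ∧ s'.reg 2 = rest.headD 0 ∧
        s'.inp = rest.tail ∧ s'.out = s.out ∧ s'.time ≤ s.time + 10 * m.size + 6 ∧
        ∀ a, 6 ≤ a → s'.reg a = s.reg a) s := by
  have hch : (digitCodes (Nat.bits m).reverse ++ rest).headD 0 ≤ 5 := by
    cases (Nat.bits m).reverse with
    | nil => exact hr'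
    | cons b' d =>
      simp only [digitCodes, List.map_cons, List.cons_append, List.headD_cons]
      have : b'.toNat ≤ 1 := b'.toNat_le
      omega
  simp only [readNum, wp_seq, wp_const, wp_sub, wp_mul, wp_read, Function.update_self,
      Function.update_of_ne, ne_eq, not_false_eq_true, Nat.reduceEqDiff, hin]
  refine ⟨by omega, by omega, ?_⟩
  refine wp_mono (readNum_loop (Nat.bits m).reverse (v := 0) (rest := rest) ?_ hr hr' ?_ ?_ ?_ ?_) ?_
  · rw [binValue_bits]; exact hl
  · simp
  · simp
  · simp
  · simp
  · rintro s' ⟨e3, e2, ei, eo, et, ef⟩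
    refine ⟨e3.trans (binValue_bits m), e2, ei, eo, ?_, fun a ha => (ef a ha).trans ?_⟩
    · rw [List.length_reverse, Nat.size_eq_bits_len] at et; simp only at et; omega
    · have : ∀ x < 6, a ≠ x := fun x hx => by omega
      simp [this]

/-- Tabulate the powers of three up to `3 ^ n`, where `n = R 39`. -/
def powTable : Cmd :=
  .prim (.const 8 0) ;; .prim (.const 9 1) ;; .prim (.const 4 1) ;; .prim (.add 10 39 4) ;;
  .loop 10 (astore 0 8 9 ;; .prim (.add 11 9 9) ;; .prim (.add 9 11 9) ;; .prim (.const 4 1) ;;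
    .prim (.add 8 8 4) ;; .prim (.sub 10 10 4))

/-- Tabulate the addresses of the output cells; `R 9` is the last power of three. -/
def cellTable : Cmd :=
  .prim (.const 4 8) ;; .prim (.mul 36 9 4) ;; .prim (.const 4 64) ;; .prim (.add 36 36 4) ;;
  .prim (.const 8 0) ;; .prim (.copy 9 36) ;; .prim (.copy 10 39) ;;
  .loop 10 (astore 1 8 9 ;; .prim (.const 4 1) ;; .prim (.add 9 9 4) ;; .prim (.add 8 8 4) ;;
    .prim (.sub 10 10 4)) ;;
  .prim (.const 4 1) ;; .prim (.sub 37 9 4)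

theorem powTable_loop {l n : ℕ} (hl : 400 * 3 ^ n ≤ 2 ^ l) (d : ℕ) {i : ℕ} {s : St}
    (hid : i + d = n + 1) (h8 : s.reg 8 = i) (h9 : s.reg 9 = 3 ^ i) (h10 : s.reg 10 = d) :
    wp l (.loop 10 (astore 0 8 9 ;; .prim (.add 11 9 9) ;; .prim (.add 9 11 9) ;;
      .prim (.const 4 1) ;; .prim (.add 8 8 4) ;; .prim (.sub 10 10 4)))
      (fun s' => s'.reg 9 = 3 ^ (n + 1) ∧ s'.inp = s.inp ∧ s'.out = s.out ∧
        s'.time ≤ s.time + 12 * d + 1 ∧ (∀ k, i ≤ k → k ≤ n → s'.reg (addr 0 k) = 3 ^ k) ∧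
        (∀ a, a = 2 ∨ 12 ≤ a → (∀ k, i ≤ k → k ≤ n → a ≠ addr 0 k) → s'.reg a = s.reg a)) s := by
  induction d generalizing i s with
  | zero =>
    refine wp_loop_done h10 ⟨?_, rfl, rfl, by simp [St.tick], fun k _ _ => by omega,
      fun _ _ _ => rfl⟩
    rw [← hid]; exact h9
  | succ d ih =>
    have hi : i ≤ n := by omega
    have h3 : 3 ^ i ≤ 3 ^ n := Nat.pow_le_pow_right (by norm_num) hi
    have hn : n < 3 ^ n := n.lt_pow_self (by norm_num)
    refine wp_loop_step (by omega) ?_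
    simp only [wp_seq, wp_add, wp_const, wp_sub, wp_astore, Function.update_self,
      Function.update_of_ne, ne_eq, not_false_eq_true, Nat.reduceEqDiff, St.tick,
      OfNat.ofNat_ne_zero, OfNat.ofNat_ne_one, small_eq_addr, Nat.reduceLT, h8, h9, h10]
    refine ⟨by omega, by omega, by omega, by omega, by omega, ?_⟩
    generalize hR : Function.update _ 10 _ = R
    have f : ∀ a, a = 2 ∨ 12 ≤ a → a ≠ addr 0 i → R a = s.reg a := by
      intro a ha h1
      have h0 : a ≠ 0 := by omega
      have h2 : a ≠ 1 := by omega
      have h3 : ∀ x, 3 ≤ x → x < 12 → a ≠ x := fun x _ hx => by omega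
      simp [← hR, h0, h1, h2, h3]
    have fi : R (addr 0 i) = 3 ^ i := by simp [← hR, addr_eq_small]
    refine wp_mono (ih (i := i + 1) (by omega) ?_ ?_ ?_) ?_
    · simp [← hR]
    · simp [← hR]; ring
    · simp [← hR]
    · rintro s' ⟨e9, ei, eo, et, ep, ef⟩
      refine ⟨e9, ei, eo, by simp only at et; omega, fun k h1 h2 => ?_, fun a ha h => ?_⟩
      · rcases h1.eq_or_lt with rfl | h1
        · refine (ef _ (by unfold addr; omega) fun k h3 h4 => ?_).trans fi
          unfold addr; omega
        · exact ep k h1 h2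
      · exact (ef a ha fun k h1 h2 => h k (by omega) h2).trans (f a ha (h i le_rfl hi))

theorem cellTable_loop {l n N : ℕ} (hl : 400 * 3 ^ n ≤ 2 ^ l) (hN : N + 2 * n + 8 < 2 ^ l) (d : ℕ)
    {i : ℕ} {s : St} (hid : i + d = n) (h8 : s.reg 8 = i) (h9 : s.reg 9 = N + i)
    (h10 : s.reg 10 = d) :
    wp l (.loop 10 (astore 1 8 9 ;; .prim (.const 4 1) ;; .prim (.add 9 9 4) ;;
      .prim (.add 8 8 4) ;; .prim (.sub 10 10 4)))
      (fun s' => s'.reg 9 = N + n ∧ s'.inp = s.inp ∧ s'.out = s.out ∧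
        s'.time ≤ s.time + 12 * d + 1 ∧ (∀ k, i ≤ k → k < n → s'.reg (addr 1 k) = N + k) ∧
        (∀ a, a = 2 ∨ 12 ≤ a → (∀ k, i ≤ k → k < n → a ≠ addr 1 k) → s'.reg a = s.reg a)) s := by
  induction d generalizing i s with
  | zero =>
    refine wp_loop_done h10 ⟨?_, rfl, rfl, by simp [St.tick], fun k _ _ => by omega,
      fun _ _ _ => rfl⟩
    rw [← hid]; exact h9
  | succ d ih =>
    have hi : i < n := by omega
    have hn : n < 3 ^ n := n.lt_pow_self (by norm_num)
    refine wp_loop_step (by omega) ?_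
    simp only [wp_seq, wp_add, wp_const, wp_sub, wp_astore, Function.update_self,
      Function.update_of_ne, ne_eq, not_false_eq_true, Nat.reduceEqDiff, St.tick,
      OfNat.ofNat_ne_zero, OfNat.ofNat_ne_one, small_eq_addr, Nat.reduceLT, h8, h9, h10]
    refine ⟨by omega, by omega, by omega, by omega, ?_⟩
    generalize hR : Function.update _ 10 _ = R
    have f : ∀ a, a = 2 ∨ 12 ≤ a → a ≠ addr 1 i → R a = s.reg a := by
      intro a ha h1
      have h0 : a ≠ 0 := by omega
      have h2 : a ≠ 1 := by omega
      have h3 : ∀ x, 3 ≤ x → x < 12 → a ≠ x := fun x _ hx => by omega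
      simp [← hR, h0, h1, h2, h3]
    have fi : R (addr 1 i) = N + i := by simp [← hR, addr_eq_small]
    refine wp_mono (ih (i := i + 1) (by omega) ?_ ?_ ?_) ?_
    · simp [← hR]
    · simp [← hR]; ring
    · simp [← hR]
    · rintro s' ⟨e9, ei, eo, et, ep, ef⟩
      refine ⟨e9, ei, eo, by simp only at et; omega, fun k h1 h2 => ?_, fun a ha h => ?_⟩
      · rcases h1.eq_or_lt with rfl | h1
        · refine (ef _ (by unfold addr; omega) fun k h3 h4 => ?_).trans fi
          unfold addr; omega
        · exact ep k h1 h2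
      · exact (ef a ha fun k h1 h2 => h k (by omega) h2).trans (f a ha (h i le_rfl hi))

theorem tables_spec {l n : ℕ} {s : St} (hl : 400 * 3 ^ n ≤ 2 ^ l) (h39 : s.reg 39 = n)
    (h0 : ∀ a, 64 ≤ a → s.reg a = 0) :
    wp l (powTable ;; cellTable) (fun s' => Inv n s'.reg ∧ s'.reg 39 = n ∧ s'.reg 2 = s.reg 2 ∧
      s'.inp = s.inp ∧ s'.out = s.out ∧ s'.time ≤ s.time + 24 * n + 40 ∧
      ∀ j, 2 ≤ j → j < 8 → ∀ i, s'.reg (addr j i) = 0) s := by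
  have hn : n < 3 ^ n := n.lt_pow_self (by norm_num)
  have hn' : 3 ^ (n + 1) = 3 * 3 ^ n := pow_succ' 3 n
  simp only [powTable, wp_seq, wp_add, wp_const, Function.update_self,
      Function.update_of_ne, ne_eq, not_false_eq_true, Nat.reduceEqDiff, h39]
  refine ⟨by omega, ?_⟩
  refine wp_mono (powTable_loop hl (n + 1) (i := 0) (by omega) ?_ ?_ ?_) ?_
  · simp
  · simp
  · simp
  rintro s₁ ⟨e9, ei, eo, et, ep, ef⟩
  have f1 : ∀ a, a = 2 ∨ 12 ≤ a → (∀ k, k ≤ n → a ≠ addr 0 k) → s₁.reg a = s.reg a := by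
    intro a ha h
    rw [ef a ha fun k _ hk => h k hk]
    have h3 : ∀ x, 3 ≤ x → x < 12 → a ≠ x := fun x _ hx => by omega
    simp [h3]
  have h39' : s₁.reg 39 = n := (f1 39 (by norm_num) fun k _ => by unfold addr; omega).trans h39
  simp only [cellTable, wp_seq, wp_add, wp_const, wp_copy, wp_mul, Function.update_self,
      Function.update_of_ne, ne_eq, not_false_eq_true, Nat.reduceEqDiff, h39', e9]
  -- The output cells start above all array entries with index below `3 ^ (n + 1)`.
  have hbase : 3 ^ (n + 1) * 8 + 64 = base n := by unfold base; ring
  rw [hbase]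
  refine ⟨by omega, by omega, ?_⟩
  have hb : base n = 64 + 24 * 3 ^ n := by unfold base; omega
  refine wp_mono (cellTable_loop (n := n) (N := base n) hl (by omega) n (i := 0) (by omega)
    ?_ ?_ ?_) ?_
  · simp
  · simp
  · simp
  rintro s₂ ⟨r9, ri, ro, rt, rp, rf⟩
  simp only at rt et
  have f2 : ∀ a, a = 2 ∨ 12 ≤ a → a ≠ 36 → (∀ k, k < n → a ≠ addr 1 k) →
      s₂.reg a = s₁.reg a := by
    intro a ha h36 h
    rw [rf a ha fun k _ hk => h k hk]
    have h3 : ∀ x, 3 ≤ x → x < 12 → a ≠ x := fun x _ hx => by omega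
    simp [h3, h36]
  have g36 : s₂.reg 36 = base n := (rf 36 (by norm_num) fun k _ _ => by unfold addr; omega).trans
    (by simp)
  simp only [wp_seq, wp_const, wp_sub, r9, Function.update_of_ne, Function.update_self, ne_eq, Nat.reduceEqDiff,
    not_false_eq_true]
  refine ⟨by omega, ?_⟩
  generalize hR : Function.update _ 37 _ = R
  have f3 : ∀ a, a = 2 ∨ 12 ≤ a → a ≠ 37 → R a = s₂.reg a := by
    intro a ha h37
    have h3 : a ≠ 4 := by omega
    simp [← hR, h3, h37]
  have f3a : ∀ j i, R (addr j i) = s₂.reg (addr j i) := fun j i =>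
    f3 _ (by unfold addr; omega) (by unfold addr; omega)
  have z : ∀ j, 2 ≤ j → j < 8 → ∀ i, R (addr j i) = 0 := by
    intro j h2 h8 i
    rw [f3a, f2 _ (by unfold addr; omega) (by unfold addr; omega), f1 _ (by unfold addr; omega),
      h0 _ (by unfold addr; omega)]
    · intro k _; rw [ne_eq, addr_inj h8 (by norm_num)]; omega
    · intro k _; rw [ne_eq, addr_inj h8 (by norm_num)]; omega
  refine ⟨⟨fun i hi => ?_, fun i hi => ?_, fun i _ => ?_, fun i _ => ?_, ?_, ?_⟩, ?_, ?_,
    ri.trans ei, ro.trans eo, by omega, z⟩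
  · rw [f3a, f2 _ (by unfold addr; omega) (by unfold addr; omega)]
    · exact ep i (by omega) hi
    · intro k _; rw [ne_eq, addr_inj (by norm_num) (by norm_num)]; omega
  · rw [f3a]; exact rp i (by omega) hi
  · rw [z 2 (by norm_num) (by norm_num)]; omega
  · rw [z 3 (by norm_num) (by norm_num)]; omega
  · exact (f3 36 (by norm_num) (by norm_num)).trans g36
  · simp [← hR]; omega
  · exact (f2 39 (by norm_num) (by norm_num) fun k _ => by unfold addr; omega).trans h39'
  · exact (f2 2 (by norm_num) (by norm_num) fun k _ => by unfold addr; omega).trans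
      (f1 2 (by norm_num) fun k _ => by unfold addr; omega)

/-- Code of a literal. -/
def litCode {n : ℕ} (x : Literal n) : ℕ := (if x.2 then 2 else 1) * 3 ^ (x.1 : ℕ)

/-- Code of a term. -/
def termCode {n : ℕ} (t : List (Literal n)) : ℕ := (t.map litCode).sum

/-- Add the codes of the literals to `R 14`, starting from the letter in `R 2`; the letter after
the last literal goes to `R 2`. -/
def readLits : Cmd :=
  .prim (.const 4 5) ;; .prim (.sub 5 4 2) ;; .prim (.mul 15 5 2) ;;
  .loop 15 (.prim (.copy 16 2) ;; readNum ;; aload 17 0 3 ;; .prim (.const 4 2) ;;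
    .prim (.sub 16 16 4) ;; .prim (.mul 17 16 17) ;; .prim (.add 14 14 17) ;;
    .prim (.const 4 5) ;; .prim (.sub 5 4 2) ;; .prim (.mul 15 5 2))

/-- The letters of a literal as they are read. -/
def litInput {n : ℕ} (x : Literal n) : List ℕ := (encodeLiteral x).map Letter.code

theorem litInput_eq {n : ℕ} (x : Literal n) : litInput x =
    (if x.2 then 4 else 3) :: digitCodes (Nat.bits x.1).reverse := by
  simp only [litInput, encodeLiteral, List.map_cons, encodeNat, List.map_map, digitCodes]
  congr 1
  · split_ifs <;> rfl
  · refine List.map_congr_left fun b _ => ?_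
    cases b <;> rfl

theorem headD_lits {n : ℕ} (t : List (Literal n)) {rest : List ℕ}
    (hr : rest.headD 0 = 0 ∨ rest.headD 0 = 5) :
    ((t.flatMap litInput ++ rest).headD 0 = 0 ∨ 3 ≤ (t.flatMap litInput ++ rest).headD 0) ∧
      (t.flatMap litInput ++ rest).headD 0 ≤ 5 := by
  cases t with
  | nil => simp only [List.flatMap_nil, List.nil_append]; omega
  | cons x t =>
    simp only [List.flatMap_cons, litInput_eq, List.cons_append, List.headD_cons]
    split_ifs <;> omega

theorem litCode_lt {n : ℕ} (x : Literal n) : litCode x < 3 ^ n := by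
  have h : 3 ^ (x.1 + 1 : ℕ) ≤ 3 ^ n := Nat.pow_le_pow_right (by norm_num) x.1.isLt
  have : 0 < 3 ^ (x.1 : ℕ) := by positivity
  rw [pow_succ] at h
  unfold litCode
  split_ifs <;> omega

/-- A literal begins with the letter 3 or 4, so letter minus 2 is its ternary digit. The product `(5
- R 2) * R 2` vanishes at the start of a new term and at the end of the input. -/
theorem readLits_loop {l n : ℕ} (hl : 400 * 3 ^ n ≤ 2 ^ l) (t : List (Literal n)) {c : ℕ}
    {rest : List ℕ} {s : St} (hr : rest.headD 0 = 0 ∨ rest.headD 0 = 5)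
    (hc : c + termCode t < 3 ^ n) (hpow : ∀ i ≤ n, s.reg (addr 0 i) = 3 ^ i)
    (h14 : s.reg 14 = c) (h2 : s.reg 2 = (t.flatMap litInput ++ rest).headD 0)
    (hin : s.inp = (t.flatMap litInput ++ rest).tail) (h15 : s.reg 15 = (5 - s.reg 2) * s.reg 2) :
    wp l (.loop 15 (.prim (.copy 16 2) ;; readNum ;; aload 17 0 3 ;; .prim (.const 4 2) ;;
      .prim (.sub 16 16 4) ;; .prim (.mul 17 16 17) ;; .prim (.add 14 14 17) ;;
      .prim (.const 4 5) ;; .prim (.sub 5 4 2) ;; .prim (.mul 15 5 2)))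
      (fun s' => s'.reg 14 = c + termCode t ∧ s'.reg 2 = rest.headD 0 ∧ s'.inp = rest.tail ∧
        s'.out = s.out ∧ s'.time ≤ s.time + (10 * n + 30) * t.length + 1 ∧
        ∀ a, a = 12 ∨ a = 13 ∨ 32 ≤ a → s'.reg a = s.reg a) s := by
  induction t generalizing c s with
  | nil =>
    simp only [List.flatMap_nil, List.nil_append] at h2 hin
    refine wp_loop_done ?_ ⟨h14, h2, hin, rfl, by simp [St.tick], fun _ _ => rfl⟩
    rw [h15, h2]
    rcases hr with h | h <;> rw [h]
  | cons x t ih =>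
    have hx := litCode_lt x
    have hcode : termCode (x :: t) = litCode x + termCode t := by simp [termCode]
    have hhd := headD_lits t hr
    rw [hcode] at hc ⊢
    simp only [List.flatMap_cons, litInput_eq, List.cons_append, List.headD_cons, List.tail_cons,
      List.append_assoc] at h2 hin
    have h15' : s.reg 15 ≠ 0 := by
      rw [h15, h2]
      split_ifs <;> norm_num
    have hn : n < 3 ^ n := n.lt_pow_self (by norm_num)
    have hxn : (x.1 : ℕ) < n := x.1.isLt
    refine wp_loop_step h15' ?_
    rw [wp_seq, wp_copy, wp_seq]
    refine wp_mono (readNum_spec (m := x.1) (rest := t.flatMap litInput ++ rest) (by omega)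
      hhd.1 hhd.2 hin) ?_
    rintro s₁ ⟨e3, e2, ei, eo, et, ef⟩
    simp only [St.tick] at et eo
    have hsize : Nat.size x.1 ≤ n :=
      Nat.size_le.2 (hxn.trans (n.lt_pow_self (by norm_num)))
    have e16 : s₁.reg 16 = if x.2 then 4 else 3 := (ef 16 (by norm_num)).trans (by
      simp only [Function.update_self, St.tick]; exact h2)
    have e14 : s₁.reg 14 = c := (ef 14 (by norm_num)).trans (by simp [St.tick, h14])
    have epow : ∀ i ≤ n, s₁.reg (addr 0 i) = 3 ^ i := fun i hi =>
      (ef _ (by unfold addr; omega)).trans (by simp [St.tick, addr_eq_small, hpow i hi])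
    have hw : (s₁.reg 16 - 2) * 3 ^ (x.1 : ℕ) = litCode x := by
      rw [e16, litCode]; split_ifs <;> rfl
    have h3 : 3 ^ (x.1 : ℕ) ≤ 3 ^ n := Nat.pow_le_pow_right (by norm_num) hxn.le
    have h16 : s₁.reg 16 ≤ 4 := by rw [e16]; split_ifs <;> omega
    simp only [wp_seq, wp_add, wp_const, wp_sub, wp_mul, wp_aload, Function.update_self,
      Function.update_of_ne, ne_eq, not_false_eq_true, Nat.reduceEqDiff, OfNat.ofNat_ne_zero,
      OfNat.ofNat_ne_one, e3, epow x.1 hxn.le, hw, e14, e2]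
    refine ⟨by omega, by omega, by omega, by omega, by omega, by omega, ?_⟩
    refine wp_mono (ih (c := c + litCode x) (by omega) ?_ ?_ ?_ ?_ ?_) ?_
    · intro i hi
      simp [St.tick, addr_eq_small, epow i hi]
    · simp [St.tick]
    · simp [St.tick, e2]
    · simp [St.tick, ei]
    · simp [St.tick, e2]
    · rintro s' ⟨r14, r2, ri, ro, rt, rf⟩
      refine ⟨by rw [r14, add_assoc], r2, ri, ro.trans eo, ?_, fun a ha => (rf a ha).trans ?_⟩
      · simp only [St.tick, List.length_cons] at rt ⊢
        rw [Nat.mul_succ]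
        omega
      · have h3 : ∀ x, 14 ≤ x → x < 32 → a ≠ x := fun x _ hx => by omega
        have h4 : ∀ x, x < 12 → a ≠ x := fun x hx => by omega
        have := ef a (by omega)
        simp only [St.tick] at this
        rw [Function.update_of_ne (h3 16 (by norm_num) (by norm_num))] at this
        simp [St.tick, h3, h4, this]

/-- Read all terms and list their codes. -/
def readTerms : Cmd :=
  aload 12 0 39 ;; .prim (.const 13 0) ;;
  .loop 2 (.prim (.const 14 0) ;; .prim (.read 2) ;; readLits ;; .prim (.add 18 12 13) ;;
    astore 2 18 14 ;; .prim (.const 4 1) ;; .prim (.add 13 13 4))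

/-- The letters of a term as they are read. -/
def termInput {n : ℕ} (t : List (Literal n)) : List ℕ := 5 :: t.flatMap litInput

theorem headD_terms {n : ℕ} (L : List (List (Literal n))) :
    (L.flatMap termInput).headD 0 = 0 ∨ (L.flatMap termInput).headD 0 = 5 := by
  cases L with
  | nil => exact .inl rfl
  | cons t L => exact .inr rfl

theorem readTerms_loop {l n : ℕ} (hl : 400 * 3 ^ n ≤ 2 ^ l) (L : List (List (Literal n))) {m : ℕ}
    {s : St} (hm : m + L.length ≤ 3 ^ n) (hL : ∀ t ∈ L, termCode t < 3 ^ n)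
    (hlen : ∀ t ∈ L, t.length ≤ n) (hpow : ∀ i ≤ n, s.reg (addr 0 i) = 3 ^ i)
    (h12 : s.reg 12 = 3 ^ n) (h13 : s.reg 13 = m)
    (h2 : s.reg 2 = (L.flatMap termInput).headD 0) (hin : s.inp = (L.flatMap termInput).tail) :
    wp l (.loop 2 (.prim (.const 14 0) ;; .prim (.read 2) ;; readLits ;; .prim (.add 18 12 13) ;;
      astore 2 18 14 ;; .prim (.const 4 1) ;; .prim (.add 13 13 4)))
      (fun s' => s'.reg 13 = m + L.length ∧ s'.out = s.out ∧
        s'.time ≤ s.time + ((10 * n + 30) * n + 20) * L.length + 1 ∧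
        (∀ (i : ℕ) (h : i < L.length), s'.reg (addr 2 (3 ^ n + m + i)) = termCode L[i]) ∧
        ∀ a, 32 ≤ a → (∀ i, 3 ^ n + m ≤ i → i < 3 ^ n + m + L.length → a ≠ addr 2 i) →
          s'.reg a = s.reg a) s := by
  induction L generalizing m s with
  | nil =>
    refine wp_loop_done h2 ⟨h13, rfl, by simp [St.tick], fun i h => by simp at h, fun _ _ _ => rfl⟩
  | cons t L ih =>
    have h2' : s.reg 2 ≠ 0 := by rw [h2]; simp [termInput]
    rw [List.length_cons] at hm
    have hn : n < 3 ^ n := n.lt_pow_self (by norm_num)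
    have ht := hL t (by simp)
    have htl := hlen t (by simp)
    have hhd := headD_lits t (headD_terms L)
    have hin' : s.inp = t.flatMap litInput ++ L.flatMap termInput := by
      rw [hin, List.flatMap_cons, termInput, List.cons_append, List.tail_cons]
    refine wp_loop_step h2' ?_
    simp only [readLits, wp_seq, wp_const, wp_read, wp_sub, wp_mul, St.tick, Function.update_self,
      Function.update_of_ne, ne_eq, not_false_eq_true, Nat.reduceEqDiff, hin']
    refine ⟨by omega, by omega, ?_⟩
    refine wp_mono (readLits_loop hl t (c := 0) (rest := L.flatMap termInput) (headD_terms L)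
      (by omega) ?_ ?_ ?_ ?_ ?_) ?_
    · intro i hi; simp [addr_eq_small, hpow i hi]
    · simp
    · simp
    · simp
    · simp
    rintro s₁ ⟨e14, e2, ei, eo, et, ef⟩
    have f1 : ∀ a, a = 12 ∨ a = 13 ∨ 32 ≤ a → s₁.reg a = s.reg a := by
      intro a ha
      rw [ef a ha]
      have h3 : ∀ x, 14 ≤ x → x < 32 → a ≠ x := fun x _ hx => by omega
      have h4 : ∀ x, x < 12 → a ≠ x := fun x hx => by omega
      simp [h3, h4]
    rw [zero_add] at e14
    simp only [wp_seq, wp_add, wp_const, wp_astore, Function.update_self, Function.update_of_ne,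
      ne_eq, not_false_eq_true, Nat.reduceEqDiff, OfNat.ofNat_ne_zero, OfNat.ofNat_ne_one,
      small_eq_addr, Nat.reduceLT, f1 12 (by norm_num), f1 13 (by norm_num), h12, h13, e14]
    refine ⟨by omega, by omega, by omega, ?_⟩
    generalize hR : Function.update _ 13 _ = R
    have f2 : ∀ a, 32 ≤ a → a ≠ addr 2 (3 ^ n + m) → R a = s.reg a := by
      intro a ha h
      have h3 : ∀ x, x < 32 → a ≠ x := fun x hx => by omega
      rw [← f1 a (by omega)]
      simp [← hR, h3, h]
    have g2 : R (addr 2 (3 ^ n + m)) = termCode t := by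
      simp [← hR, addr_eq_small]
    refine wp_mono (ih (m := m + 1) (by omega) (fun u hu => hL u (by simp [hu]))
      (fun u hu => hlen u (by simp [hu])) ?_ ?_ ?_ ?_ ?_) ?_
    · intro i hi
      exact (f2 _ (by unfold addr; omega) (by unfold addr; omega)).trans (hpow i hi)
    · simp [← hR, small_eq_addr, f1 12, h12]
    · simp [← hR]
    · simp [← hR, small_eq_addr, e2]
    · exact ei
    · rintro s' ⟨r13, ro, rt, rl, rf⟩
      refine ⟨by rw [r13, List.length_cons]; ring, ro.trans eo, ?_, ?_, ?_⟩
      · simp only [List.length_cons] at rt et ⊢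
        have : (10 * n + 30) * t.length ≤ (10 * n + 30) * n := Nat.mul_le_mul_left _ htl
        rw [Nat.mul_succ]
        omega
      · intro i hi
        cases i with
        | zero =>
          refine (rf _ (by unfold addr; omega) fun i h1 _ => ?_).trans g2
          unfold addr; omega
        | succ i =>
          have := rl i (by simpa using hi)
          rw [show 3 ^ n + (m + 1) + i = 3 ^ n + m + (i + 1) by ring] at this
          simpa using this
      · intro a ha h
        simp only [List.length_cons] at h
        exact (rf a ha fun i h1 h2 => h i (by omega) (by omega)).trans
          (f2 a ha (h _ le_rfl (by omega)))

/-- Everything that precedes the search. -/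
def prepare : Cmd :=
  readNum ;; .prim (.copy 39 3) ;; (powTable ;; cellTable) ;; readTerms ;; astore 4 39 13 ;;
  .prim (.copy 32 39) ;; .ite 13 (.prim (.const 4 3) ;; astore 5 32 4) .skip ;; aload 38 5 32

theorem termInput_eq {n : ℕ} (t : List (Literal n)) :
    (encodeTerm t).map Letter.code = termInput t := by
  rw [encodeTerm, termInput, List.map_cons, List.map_flatMap]
  rfl

theorem input_eq {n : ℕ} (L : List (List (Literal n))) : (encodeTerms L).map Letter.code =
    digitCodes (Nat.bits n).reverse ++ L.flatMap termInput := by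
  rw [encodeTerms, List.map_append, List.map_flatMap]
  congr 1
  · simp only [encodeNat, List.map_map, digitCodes]
    refine List.map_congr_left fun b _ => ?_
    cases b <;> rfl
  · simp only [termInput_eq]

theorem prepare_spec {n : ℕ} {L : List (List (Literal n))} (hm : L.length ≤ 3 ^ n)
    (hL : ∀ t ∈ L, termCode t < 3 ^ n) (hlen : ∀ t ∈ L, t.length ≤ n)
    (hnd : (L.map termCode).Nodup) :
    wp (2 * n + 9) prepare (fun s' => s'.out = [] ∧
      s'.time ≤ ((10 * n + 30) * n + 20) * L.length + 34 * n + 80 ∧ Inv n s'.reg ∧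
      s'.reg (addr 5 (n + 1)) = 0 ∧ (L = [] → s'.reg 38 = 0) ∧
      (L ≠ [] → Level s'.reg n (L.map termCode).toFinset ∧ s'.reg 32 = n ∧ s'.reg 38 = 3 ∧
        s'.reg (addr 5 n) = 3))
      ⟨fun _ => 0, (encodeTerms L).map Letter.code, [], 0⟩ := by
  have hl := capacity n
  have hn : n < 3 ^ n := n.lt_pow_self (by norm_num)
  have hn' : 3 ^ (n + 1) = 3 * 3 ^ n := pow_succ' 3 n
  have hhd := headD_terms L
  rw [prepare, wp_seq]
  refine wp_mono (readNum_spec (m := n) (rest := L.flatMap termInput) (by omega) (by omega)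
    (by omega) (input_eq L)) ?_
  rintro s₁ ⟨e3, e2, ei, eo, et, ef⟩
  have hsize : Nat.size n ≤ n := Nat.size_le.2 (n.lt_pow_self (by norm_num))
  simp only at et eo ef
  rw [wp_seq, wp_copy, wp_seq]
  refine wp_mono (tables_spec hl ?_ ?_) ?_
  · simp [e3]
  · intro a ha
    have h39 : a ≠ 39 := by omega
    simp [h39, ef a (by omega)]
  rintro s₂ ⟨fI, f39, f2, fi, fo, ft, fz⟩
  simp only [Function.update_of_ne, ne_eq, Nat.reduceEqDiff, not_false_eq_true] at f2 fi fo ft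
  simp only [readTerms, wp_seq, wp_aload, wp_const, ne_eq, OfNat.ofNat_ne_zero, not_false_eq_true,
    f39, fI.pow n le_rfl]
  refine ⟨by omega, ?_⟩
  generalize hR : Function.update (β := fun _ => ℕ) _ 13 0 = R
  have f3 : ∀ a, 32 ≤ a → R a = s₂.reg a := by
    intro a ha
    have h3 : ∀ x, x < 32 → a ≠ x := fun x hx => by omega
    simp [← hR, h3]
  have f3a : ∀ j i, R (addr j i) = s₂.reg (addr j i) := fun j i => f3 _ (by unfold addr; omega)
  refine wp_mono (readTerms_loop hl L (m := 0) (by omega) hL hlen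
    (fun i hi => (f3a 0 i).trans (fI.pow i hi)) ?_ ?_ ?_ ?_) ?_
  · simp [← hR]
  · simp [← hR]
  · simp [← hR, f2, e2]
  · exact fi.trans ei
  rintro s₃ ⟨g13, go, gt, gl, gf⟩
  rw [zero_add] at g13
  simp only [add_zero] at gl gf gt
  have gfa : ∀ j, j < 8 → j ≠ 2 → ∀ i, s₃.reg (addr j i) = s₂.reg (addr j i) := fun j hj hj2 i =>
    (gf _ (by unfold addr; omega) fun k _ _ => by
      rw [ne_eq, addr_inj hj (by norm_num)]; omega).trans (f3a j i)
  have gfs : ∀ x, 32 ≤ x → x < 64 → s₃.reg x = s₂.reg x := fun x h1 h2 =>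
    (gf x h1 fun k _ _ => by unfold addr; omega).trans (f3 x h1)
  have g39 : s₃.reg 39 = n := (gfs 39 (by norm_num) (by norm_num)).trans f39
  have hz : ∀ i, s₃.reg (addr 5 i) = 0 := fun i =>
    (gfa 5 (by norm_num) (by norm_num) i).trans (fz 5 (by norm_num) (by norm_num) i)
  have hI₃ : Inv n s₃.reg := by
    refine ⟨fun i hi => ?_, fun i hi => ?_, fun i hi => ?_, fun i hi => ?_, ?_, ?_⟩
    · rw [gfa 0 (by norm_num) (by norm_num)]; exact fI.pow i hi
    · rw [gfa 1 (by norm_num) (by norm_num)]; exact fI.cell i hi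
    -- The entries just written are codes below `3 ^ n`, hence at most their index; all others are
    -- unchanged.
    · by_cases h : 3 ^ n ≤ i ∧ i < 3 ^ n + L.length
      · obtain ⟨k, rfl⟩ := Nat.exists_eq_add_of_le h.1
        rw [gl k (by omega)]
        exact (hL _ (List.getElem_mem _)).le.trans (by omega)
      · rw [gf _ (by unfold addr; omega), f3a]
        · exact fI.list i hi
        · intro k h1 h2; unfold addr; omega
    · rw [gfa 3 (by norm_num) (by norm_num)]; exact fI.pos i hi
    · rw [gfs 36 (by norm_num) (by norm_num)]; exact fI.first
    · rw [gfs 37 (by norm_num) (by norm_num)]; exact fI.last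
  simp only [wp_ite, wp_skip, wp_seq, wp_copy, wp_const, wp_aload, wp_astore, ne_eq,
    OfNat.ofNat_ne_zero, OfNat.ofNat_ne_one, not_false_eq_true, g39, g13, Function.update_self,
    Function.update_of_ne, Nat.reduceEqDiff, small_eq_addr, addr_eq_small, Nat.reduceLT, St.tick]
  refine ⟨by omega, fun hne => ⟨by omega, by omega, ?_⟩, fun h0 => ⟨by omega, ?_⟩⟩
  · generalize hR' : Function.update (β := fun _ => ℕ) _ 38 3 = R'
    have k : ∀ a, 33 ≤ a → a ≠ 38 → a ≠ addr 4 n → a ≠ addr 5 n → R' a = s₃.reg a := by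
      intro a ha h1 h2 h3
      have h4 : ∀ x, x < 33 → a ≠ x := fun x hx => by omega
      simp [← hR', h1, h2, h3, h4]
    have ka : ∀ j, j < 8 → ∀ i, (j ≠ 4 ∨ i ≠ n) → (j ≠ 5 ∨ i ≠ n) →
        R' (addr j i) = s₃.reg (addr j i) := fun j hj i h1 h2 =>
      k _ (by unfold addr; omega) (by unfold addr; omega)
        (by rw [ne_eq, addr_inj hj (by norm_num)]; omega)
        (by rw [ne_eq, addr_inj hj (by norm_num)]; omega)
    have hcard : (L.map termCode).toFinset.card = L.length := by
      rw [List.toFinset_card_of_nodup hnd, List.length_map]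
    refine ⟨go.trans (fo.trans eo), by omega, ?_, ?_, fun h => absurd (by simp [h]) hne,
      fun _ => ⟨⟨?_, ?_, ?_⟩, ?_, ?_, ?_⟩⟩
    · exact hI₃.congr (k 36 (by norm_num) (by norm_num) (by unfold addr; omega)
        (by unfold addr; omega)) (k 37 (by norm_num) (by norm_num) (by unfold addr; omega)
        (by unfold addr; omega)) fun j hj i _ => ka j (by omega) i (by omega) (by omega)
    · simp [addr_inj, addr_eq_small, hz]
    · rw [hcard]
      simp [← hR', addr_inj, addr_eq_small]
    · unfold Lists
      rw [hcard]
      congr 1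
      refine List.ext_getElem (by simp) fun i h1 h2 => ?_
      rw [List.length_map] at h2
      rw [List.getElem_map, List.getElem_range, List.getElem_map,
        ka 2 (by norm_num) _ (by norm_num) (by norm_num)]
      exact gl i h2
    · intro c hc
      rw [List.mem_toFinset, List.mem_map] at hc
      obtain ⟨t, ht, rfl⟩ := hc
      exact hL t ht
    · simp
    · simp
    · simp
  · generalize hR' : Function.update (β := fun _ => ℕ) _ 38 _ = R'
    have k : ∀ a, 33 ≤ a → a ≠ 38 → a ≠ addr 4 n → R' a = s₃.reg a := by
      intro a ha h1 h2
      have h4 : ∀ x, x < 33 → a ≠ x := fun x hx => by omega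
      simp [← hR', h1, h2, h4]
    have ka : ∀ j, j < 8 → ∀ i, (j ≠ 4 ∨ i ≠ n) → R' (addr j i) = s₃.reg (addr j i) :=
      fun j hj i h1 => k _ (by unfold addr; omega) (by unfold addr; omega)
        (by rw [ne_eq, addr_inj hj (by norm_num)]; omega)
    refine ⟨go.trans (fo.trans eo), by omega, ?_, ?_, fun _ => ?_,
      fun h => absurd (List.length_eq_zero_iff.1 h0) h⟩
    · exact hI₃.congr (k 36 (by norm_num) (by norm_num) (by unfold addr; omega))
        (k 37 (by norm_num) (by norm_num) (by unfold addr; omega))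
        fun j hj i _ => ka j (by omega) i (by omega)
    · simp [addr_inj, addr_eq_small, hz]
    · simp [addr_inj, addr_eq_small, hz]

end DNFEnum
namespace DNFEnum
open RAM Finset

/-! ### Terms and their codes -/

/-- The number with ternary digits `f 0, …, f (r - 1)`. -/
def ternary : ℕ → (ℕ → ℕ) → ℕ
  | 0, _ => 0
  | r + 1, f => f r * 3 ^ r + ternary r f

/-- The digits of the code of a term. -/
def termDigits {n : ℕ} : List (Literal n) → ℕ → ℕ
  | [] => fun _ => 0
  | x :: t => Function.update (termDigits t) x.1 (if x.2 then 2 else 1)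

theorem ternary_lt {r : ℕ} {f : ℕ → ℕ} (hf : ∀ i, f i < 3) : ternary r f < 3 ^ r := by
  induction r with
  | zero => simp [ternary]
  | succ r ih =>
    have h : f r * 3 ^ r ≤ 2 * 3 ^ r := Nat.mul_le_mul_right _ (by have := hf r; omega)
    rw [ternary, pow_succ]
    omega

theorem ternary_succ_div {r : ℕ} {f : ℕ → ℕ} (hf : ∀ i, f i < 3) :
    ternary (r + 1) f / 3 ^ r = f r := by
  rw [ternary, mul_comm, Nat.mul_add_div (by positivity), Nat.div_eq_of_lt (ternary_lt hf),
    add_zero]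

theorem ternary_succ_mod {r : ℕ} {f : ℕ → ℕ} (hf : ∀ i, f i < 3) :
    ternary (r + 1) f % 3 ^ r = ternary r f := by
  rw [ternary, mul_comm, Nat.mul_add_mod, Nat.mod_eq_of_lt (ternary_lt hf)]

theorem ternary_injective {r : ℕ} {f g : ℕ → ℕ} (hf : ∀ i, f i < 3) (hg : ∀ i, g i < 3)
    (h : ternary r f = ternary r g) : ∀ i < r, f i = g i := by
  induction r with
  | zero => intro i hi; omega
  | succ r ih =>
    intro i hi
    rcases Nat.lt_succ_iff_lt_or_eq.1 hi with hi | rfl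
    · refine ih ?_ i hi
      rw [← ternary_succ_mod hf, h, ternary_succ_mod hg]
    · rw [← ternary_succ_div hf, h, ternary_succ_div hg]

theorem ternary_congr {r : ℕ} {f g : ℕ → ℕ} (h : ∀ i < r, f i = g i) :
    ternary r f = ternary r g := by
  induction r with
  | zero => rfl
  | succ r ih => rw [ternary, ternary, h r (by omega), ih fun i hi => h i (by omega)]

/-- Setting a digit amounts to an addition because the old digit is 0. For terms this holds since
their literals have different variables. -/
theorem ternary_update {r i d : ℕ} {f : ℕ → ℕ} (hi : i < r) (h0 : f i = 0) :
    ternary r (Function.update f i d) = d * 3 ^ i + ternary r f := by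
  induction r with
  | zero => omega
  | succ r ih =>
    rw [ternary, ternary]
    rcases Nat.lt_succ_iff_lt_or_eq.1 hi with hi | rfl
    · rw [ih hi, Function.update_of_ne (by omega)]; ring
    · rw [Function.update_self, h0, zero_mul, zero_add,
        ternary_congr fun j hj => Function.update_of_ne (by omega) _ _]

theorem width_ternary {r : ℕ} {f : ℕ → ℕ} (hf : ∀ i, f i < 3) :
    width r (ternary r f) = ((range r).filter fun i => f i ≠ 0).card := by
  induction r with
  | zero => rfl
  | succ r ih =>
    rw [width, ternary_succ_div hf, ternary_succ_mod hf, ih, range_add_one, filter_insert]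
    by_cases h : f r = 0
    · simp [h]
    · simp [h, add_comm]

theorem sat_ternary {r : ℕ} {f : ℕ → ℕ} (hf : ∀ i, f i < 3) (v : List ℕ) :
    Sat r (ternary r f) v ↔ ∀ i < r, Compat (v.getD i 0) (f i) := by
  induction r with
  | zero => simp [Sat]
  | succ r ih =>
    rw [Sat, ternary_succ_div hf, ternary_succ_mod hf, ih]
    constructor
    · rintro ⟨h1, h2⟩ i hi
      rcases Nat.lt_succ_iff_lt_or_eq.1 hi with hi | rfl
      · exact h2 i hi
      · exact h1
    · exact fun h => ⟨h r (by omega), fun i hi => h i (by omega)⟩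

variable {n : ℕ}

theorem termDigits_lt (t : List (Literal n)) (i : ℕ) : termDigits t i < 3 := by
  induction t with
  | nil => simp [termDigits]
  | cons x t ih =>
    simp only [termDigits, Function.update_apply]
    split_ifs <;> omega

theorem termDigits_eq_zero {t : List (Literal n)} {i : ℕ} :
    termDigits t i = 0 ↔ ∀ x ∈ t, (x.1 : ℕ) ≠ i := by
  induction t with
  | nil => simp [termDigits]
  | cons x t ih =>
    simp only [termDigits, Function.update_apply, List.mem_cons, forall_eq_or_imp]
    split_ifs with h h'
    · simp [h]
    · simp [h]
    · rw [ih]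
      simp [Ne.symm h]

theorem termDigits_of_mem {t : List (Literal n)} (ht : (t.map Prod.fst).Nodup) {x : Literal n}
    (hx : x ∈ t) : termDigits t x.1 = if x.2 then 2 else 1 := by
  induction t with
  | nil => simp at hx
  | cons y t ih =>
    rw [List.map_cons, List.nodup_cons] at ht
    simp only [termDigits, Function.update_apply]
    rcases List.mem_cons.1 hx with rfl | hx
    · simp
    · rw [if_neg, ih ht.2 hx]
      intro h
      exact ht.1 (List.mem_map.2 ⟨x, hx, Fin.ext h⟩)

/-- A nonzero digit comes from some literal on that variable, and its value gives the sign. Hence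
the code determines the term. -/
theorem mem_iff_termDigits {t : List (Literal n)} (ht : (t.map Prod.fst).Nodup) (x : Literal n) :
    x ∈ t ↔ termDigits t x.1 = if x.2 then 2 else 1 := by
  refine ⟨termDigits_of_mem ht, fun h => ?_⟩
  have h0 : termDigits t x.1 ≠ 0 := by rw [h]; split_ifs <;> norm_num
  rw [ne_eq, termDigits_eq_zero] at h0
  push Not at h0
  obtain ⟨y, hy, hyx⟩ := h0
  have h1 := termDigits_of_mem ht hy
  rw [hyx, h] at h1
  obtain ⟨a, b⟩ := x
  obtain ⟨a', b'⟩ := y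
  have : a' = a := Fin.ext hyx
  subst this
  cases b <;> cases b' <;> simp at h1 <;> exact hy

theorem termCode_eq {t : List (Literal n)} (ht : (t.map Prod.fst).Nodup) :
    termCode t = ternary n (termDigits t) := by
  induction t with
  | nil =>
    have : ∀ r, ternary r (fun _ => 0) = 0 := fun r => by
      induction r with
      | zero => rfl
      | succ r ih => rw [ternary, ih]; simp
    exact (this n).symm
  | cons x t ih =>
    rw [List.map_cons, List.nodup_cons] at ht
    rw [termDigits, ternary_update x.1.isLt, ← ih ht.2]
    · simp [termCode, litCode]
    · rw [termDigits_eq_zero]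
      intro y hy h
      exact ht.1 (List.mem_map.2 ⟨y, hy, Fin.ext h⟩)

theorem termCode_lt {t : List (Literal n)} (ht : (t.map Prod.fst).Nodup) : termCode t < 3 ^ n := by
  rw [termCode_eq ht]
  exact ternary_lt (termDigits_lt t)

/-- It makes the list of codes of the input free of repetitions, as `Level` requires at the root. -/
theorem toFinset_eq_of_termCode {t u : List (Literal n)} (ht : (t.map Prod.fst).Nodup)
    (hu : (u.map Prod.fst).Nodup) (h : termCode t = termCode u) : t.toFinset = u.toFinset := by
  rw [termCode_eq ht, termCode_eq hu] at h
  have h' := ternary_injective (termDigits_lt t) (termDigits_lt u) h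
  ext x
  rw [List.mem_toFinset, List.mem_toFinset, mem_iff_termDigits ht, mem_iff_termDigits hu,
    h' _ x.1.isLt]

theorem width_termCode_le {t : List (Literal n)} (ht : (t.map Prod.fst).Nodup) :
    width n (termCode t) ≤ t.length := by
  rw [termCode_eq ht, width_ternary (termDigits_lt t)]
  calc _ ≤ (t.map fun x => (x.1 : ℕ)).toFinset.card := by
        refine card_le_card fun i hi => ?_
        simp only [mem_filter, ne_eq, termDigits_eq_zero] at hi
        have := hi.2
        push Not at this
        simpa using this
    _ ≤ _ := (List.toFinset_card_le _).trans (by simp)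

theorem sat_termCode {t : List (Literal n)} (ht : (t.map Prod.fst).Nodup) (α : Fin n → Bool) :
    Sat n (termCode t) (modelWord α) ↔ ∀ x ∈ t, Literal.eval α x = true := by
  rw [termCode_eq ht, sat_ternary (termDigits_lt t)]
  have hget : ∀ i : Fin n, (modelWord α).getD i 0 = if α i then 1 else 0 := by
    intro i
    simp [modelWord, List.getD_eq_getElem?_getD]
  constructor
  · intro h x hx
    have h1 := h x.1 x.1.isLt
    rw [termDigits_of_mem ht hx, hget] at h1
    unfold Literal.eval Compat at *
    cases hx2 : x.2 <;> cases hα : α x.1 <;> simp [hx2, hα] at h1 ⊢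
  · intro h i hi
    by_cases h0 : termDigits t i = 0
    · exact .inl h0
    · rw [termDigits_eq_zero] at h0
      push Not at h0
      obtain ⟨x, hx, rfl⟩ := h0
      have h1 := h x hx
      rw [termDigits_of_mem ht hx, hget]
      unfold Literal.eval Compat at *
      cases hx2 : x.2 <;> cases hα : α x.1 <;> simp [hx2, hα] at h1 ⊢

/-! ### Output words and models of the formula -/

theorem exists_modelWord {v : List ℕ} (hv : v.length = n) (hb : ∀ b ∈ v, b ≤ 1) :
    ∃ α : Fin n → Bool, v = modelWord α := by
  subst hv
  refine ⟨fun i => v[i] == 1, List.ext_getElem (by simp [modelWord]) fun i h1 h2 => ?_⟩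
  have := hb _ (List.getElem_mem h1)
  simp only [modelWord, List.getElem_ofFn, beq_iff_eq, Fin.getElem_fin]
  split_ifs <;> omega

theorem nodup_fst {t : List (Literal n)} (hn : t.Nodup) (ht : IsTerm t.toFinset) :
    (t.map Prod.fst).Nodup :=
  List.Nodup.map_on (fun x hx y hy h => ht x (by simpa using hx) y (by simpa using hy) h) hn

theorem enumeratesModels {D : DNF n} {L : List (List (Literal n))} (hL : IsListing L D)
    (hne : L ≠ []) : EnumeratesModels (models n (L.map termCode).toFinset []) D := by
  obtain ⟨h1, h2, h3⟩ := hL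
  have hfst : ∀ t ∈ L, (t.map Prod.fst).Nodup := fun t ht =>
    nodup_fst (h1 t ht) (D.isTerm _ ((h3 _).1 (List.mem_map_of_mem ht)))
  have hS : (L.map termCode).toFinset.Nonempty := by
    rw [List.toFinset_nonempty_iff]; simpa using hne
  have hmod : ∀ α : Fin n → Bool, D.IsModel α ↔
      ∃ c ∈ (L.map termCode).toFinset, Sat n c (modelWord α) := by
    intro α
    constructor
    · rintro ⟨T, hT, h⟩
      obtain ⟨t, ht, rfl⟩ := List.mem_map.1 ((h3 T).2 hT)
      exact ⟨termCode t, by simpa using ⟨t, ht, rfl⟩,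
        (sat_termCode (hfst t ht) α).2 fun x hx => h x (by simpa using hx)⟩
    · rintro ⟨c, hc, h⟩
      rw [List.mem_toFinset, List.mem_map] at hc
      obtain ⟨t, ht, rfl⟩ := hc
      exact ⟨_, (h3 _).1 (List.mem_map_of_mem ht), fun x hx =>
        (sat_termCode (hfst t ht) α).1 h x (by simpa using hx)⟩
  refine ⟨nodup_models _ _ _, fun y => ?_⟩
  rw [mem_models hS]
  constructor
  · rintro ⟨v, hv, hb, rfl, h⟩
    obtain ⟨α, rfl⟩ := exists_modelWord hv hb
    exact ⟨α, (hmod α).2 h, by simp⟩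
  · rintro ⟨α, hα, rfl⟩
    refine ⟨modelWord α, by simp [modelWord], ?_, by simp, (hmod α).1 hα⟩
    intro b hb
    rw [modelWord, List.mem_ofFn] at hb
    obtain ⟨i, rfl⟩ := hb
    split_ifs <;> omega

/-- The enumeration program. -/
def enumerate : Cmd := prepare ;; search

/-- Distinct terms have distinct codes below `3 ^ n`, so the list fits into its segment of array 2.
The factor `(n + 2) ^ 3` is the quadratic step count of reading a term, multiplied by the linear
price of a step. -/
theorem enumerate_spec {D : DNF n} {L : List (List (Literal n))} (hL : IsListing L D) :
    ∃ ys t, HaltsWith (enumerate.compile 0) ((encodeTerms L).map Letter.code) ys t ∧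
      EnumeratesModels ys D ∧ (L ≠ [] → (L.map termCode).toFinset.Nonempty ∧
        ys = models n (L.map termCode).toFinset [] ∧
        t ≤ 20000 * (searchCost n (L.map termCode).toFinset +
          (n + 2) ^ 3 * ((L.map termCode).toFinset.card + 1))) := by
  have hfst : ∀ t ∈ L, (t.map Prod.fst).Nodup := fun t ht =>
    nodup_fst (hL.1 t ht) (D.isTerm _ ((hL.2.2 _).1 (List.mem_map_of_mem ht)))
  have hnd : (L.map termCode).Nodup := by
    refine List.Nodup.map_on (fun t ht u hu h => ?_) hL.2.1.of_map
    exact List.inj_on_of_nodup_map hL.2.1 ht hu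
      (toFinset_eq_of_termCode (hfst t ht) (hfst u hu) h)
  have hlt : ∀ t ∈ L, termCode t < 3 ^ n := fun t ht => termCode_lt (hfst t ht)
  have hlen : ∀ t ∈ L, t.length ≤ n := fun t ht => by
    have := (hfst t ht).length_le_card
    simpa using this
  have hcard : (L.map termCode).toFinset.card = L.length := by
    rw [List.toFinset_card_of_nodup hnd, List.length_map]
  have hm : L.length ≤ 3 ^ n := by
    rw [← hcard, ← card_range (3 ^ n)]
    refine card_le_card fun c hc => ?_
    rw [List.mem_toFinset, List.mem_map] at hc
    obtain ⟨t, ht, rfl⟩ := hc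
    exact mem_range.2 (hlt t ht)
  obtain ⟨s₁, hex, ho, ht, hI, hz, hemp, hne⟩ := prepare_spec hm hlt hlen hnd
  obtain ⟨t₁, ht₁, hex₁⟩ := hex.real.2 0
  by_cases hLe : L = []
  · refine ⟨[], t₁ + 1, ?_, ⟨by simp, fun y => ?_⟩, fun h => absurd hLe h⟩
    · have := (Exec.seq hex₁ (.loopDone (x := 38) (a := searchStep) (hemp hLe))).haltsWith
      rw [show ((s₁.withTime t₁).tick 1).out = [] from ho] at this
      exact this
    · simp only [List.not_mem_nil, false_iff, not_exists, not_and]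
      rintro α ⟨T, hT, -⟩
      have := (hL.2.2 T).2 hT
      simp [hLe] at this
  · obtain ⟨hlev, h32, h38, h5⟩ := hne hLe
    obtain ⟨s₂, k1, k2, k3, k4, k5⟩ := search_spec (s := s₁.withTime t₁) le_rfl hI hlev h32 h38 h5
    -- The search of the root returns to level `n + 1`, whose counter was never set and is 0; this
    -- ends the loop.
    have h0 : s₂.reg 38 = 0 := by
      rw [k2.tries, k2.frame.tries _ (by omega) le_rfl]; exact hz
    have hex₂ : Exec realCost search (s₁.withTime t₁) (s₂.tick 1) := k1 _ (.loopDone h0)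
    have hsuf : suffix n n (s₁.withTime t₁).reg = [] := by simp [suffix]
    rw [hsuf, show (s₁.withTime t₁).out = [] from ho, List.nil_append] at k4
    refine ⟨s₂.out, s₂.time + 1, (Exec.seq hex₁ hex₂).haltsWith, ?_, fun _ => ⟨?_, k4, ?_⟩⟩
    · rw [k4]; exact enumeratesModels hL hLe
    · rw [List.toFinset_nonempty_iff]; simpa using hLe
    · rw [hcard]
      simp only [St.withTime, mul_zero, zero_add, add_zero] at k5 ht₁
      have e1 : (2 * (2 * n + 9) + 1) * s₁.time ≤ (2 * (2 * n + 9) + 1) *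
          (((10 * n + 30) * n + 20) * L.length + 34 * n + 80) := Nat.mul_le_mul_left _ ht
      have e2 : ((10 * n + 30) * n + 20) * L.length + 34 * n + 80 ≤
          80 * (n + 2) ^ 2 * (L.length + 1) := by nlinarith [Nat.zero_le (n * L.length), Nat.zero_le (n ^ 2 * L.length)]
      have e3 : 2 * (2 * n + 9) + 1 ≤ 10 * (n + 2) := by omega
      have e4 := Nat.mul_le_mul e3 e2
      have e5 : 10 * (n + 2) * (80 * (n + 2) ^ 2 * (L.length + 1)) =
        800 * ((n + 2) ^ 3 * (L.length + 1)) := by ring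
      have e6 : 0 < (n + 2) ^ 3 * (L.length + 1) := by positivity
      omega

end DNFEnum

/-! ### The average delay -/

theorem mainTheorem7 :
    ∃ (P : DNFEnum.RAM.Program) (C : ℝ),
      ∀ (k n : ℕ) (D : DNFEnum.DNF n), D.IsKDNF k →
        ∀ x : List DNFEnum.Letter, DNFEnum.Encodes x D →
          ∃ (ys : List (List ℕ)) (t : ℕ),
            DNFEnum.RAM.HaltsWith P (x.map DNFEnum.Letter.code) ys t ∧
            DNFEnum.EnumeratesModels ys D ∧
            (D.terms.Nonempty →
              DNFEnum.averageDelay t ys ≤ C * (2 : ℝ) ^ (3 * (k : ℝ) / 2)) := by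
  obtain ⟨C, hC, hbound⟩ := DNFEnum.exists_time_bound
  refine ⟨DNFEnum.enumerate.compile 0, 20000 * C, ?_⟩
  rintro k n D hD x ⟨L, hL, rfl⟩
  obtain ⟨ys, t, h1, h2, h3⟩ := DNFEnum.enumerate_spec hL
  refine ⟨ys, t, h1, h2, fun ⟨T, hT⟩ => ?_⟩
  have hfst : ∀ t ∈ L, (t.map Prod.fst).Nodup := fun t ht =>
    DNFEnum.nodup_fst (hL.1 t ht) (D.isTerm _ ((hL.2.2 _).1 (List.mem_map_of_mem ht)))
  have hne : L ≠ [] := by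
    rintro rfl
    have := (hL.2.2 T).2 hT
    simp at this
  obtain ⟨h4, h5, h6⟩ := h3 hne
  have h7 := hbound n k (L.map DNFEnum.termCode).toFinset h4 (fun c hc => by
    rw [List.mem_toFinset, List.mem_map] at hc
    obtain ⟨t, ht, rfl⟩ := hc
    exact DNFEnum.termCode_lt (hfst t ht)) (fun c hc => by
    rw [List.mem_toFinset, List.mem_map] at hc
    obtain ⟨t, ht, rfl⟩ := hc
    refine (DNFEnum.width_termCode_le (hfst t ht)).trans ?_
    -- The literals of a term are listed without repetition, so the length of the list is the
    -- cardinality that `k` bounds.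
    rw [← List.toFinset_card_of_nodup (hL.1 t ht)]
    exact hD _ ((hL.2.2 _).1 (List.mem_map_of_mem ht)))
  have h8 : (t : ℝ) ≤ 20000 * (DNFEnum.searchCost n (L.map DNFEnum.termCode).toFinset +
      ((n : ℝ) + 2) ^ 3 * ((L.map DNFEnum.termCode).toFinset.card + 1)) := by exact_mod_cast h6
  have hlen : ys.length = DNFEnum.numModels n (L.map DNFEnum.termCode).toFinset := by
    rw [h5, DNFEnum.length_models]
  rw [DNFEnum.averageDelay, hlen]
  refine div_le_of_le_mul₀ (by positivity) (by positivity) ?_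
  nlinarith
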